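/- **Setting.** Identify $\mathbb{R}^N\times\mathbb{R}^d$ with $\mathbb{R}^{N+d}$, with the Euclidean norm, inner product and Lebesgue measure. For integrable $f:\mathbb{R}^N\times\mathbb{R}^d\to\mathbb{R}$ put $\widehat f(\xi)=\int e^{-2\pi \mathrm{i}\,y\cdot\xi}f(y)\,dy$. Let $\mathcal F$ be the set of continuous integrable $f$ with $\|\widehat f\|_1=\int|\widehat f(\xi)|\,d\xi<\infty$, and for $R>0$ let $\mathcal F_R=\{f\in\mathcal F:\|\widehat f\|_1\le R\}$. For $M>0$ and continuous $f,g$ put $\|f-g\|_{\infty,M}=\sup_{p\in[-M,M]^{N+d}}|f(p)-g(p)|$. **The network.** Let $n\ge 1$, let $\mathfrak n$ be the least integer with $2^{\mathfrak n}\ge 4n$, and let $n_0=2^{\mathfrak n}-4n$. Let $\mathtt H$ be the Hadamard gate, $\mathtt R_{\mathrm z}(\alpha)=\mathrm{diag}(e^{-\mathrm{i}\alpha/2},e^{\mathrm{i}\alpha/2})$ and $\mathtt R_{\mathrm y}(\gamma)=\begin{pmatrix}\cos(\gamma/2)&-\sin(\gamma/2)\\ \sin(\gamma/2)&\cos(\gamma/2)\end{pmatrix}$.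 For $\boldsymbol\theta=(\boldsymbol a^i,b^i,\gamma^i)_{i=1}^n\in\boldsymbol\Theta=(\mathbb{R}^{N+d}\times\mathbb{R}\times[0,2\pi])^n$ and $p=(\boldsymbol x,\boldsymbol z)\in\mathbb{R}^N\times\mathbb{R}^d$ let $$\mathtt U_1^{(i)}(p)=\mathtt H\,\mathtt R_{\mathrm z}(-b^i)\,\mathtt R_{\mathrm z}(-a^i_{N+d}p_{N+d})\cdots\mathtt R_{\mathrm z}(-a^i_1p_1)\,\mathtt H,\qquad \bar{\mathtt U}^{(i)}(p)=\mathtt U_1^{(i)}(p)\otimes\mathtt R_{\mathrm y}(\gamma^i),$$ and let $\mathtt U_{\boldsymbol\theta}(p)\in\mathbb{C}^{2^{\mathfrak n}\times 2^{\mathfrak n}}$ be the block-diagonal matrix with blocks $\bar{\mathtt U}^{(1)}(p),\dots,\bar{\mathtt U}^{(n)}(p),\mathbf 1_{n_0\times n_0}$. Let $\mathtt V$ be any unitary $2^{\mathfrak n}\times2^{\mathfrak n}$ matrix with $\mathtt V|0\rangle=\frac1{\sqrt n}\sum_{i=0}^{n-1}|4i\rangle$, where $|0\rangle,\dots,|2^{\mathfrak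 n}-1\rangle$ is the standard basis. For $m\in\{0,1,2,3\}$ let $$\mathbb P_m^{n,\boldsymbol\theta}(p)=\sum_{i=0}^{n-1}\big|\langle 4i+m|\,\mathtt U_{\boldsymbol\theta}(p)\mathtt V\,|0\rangle\big|^2 .$$ For $R>0$ and $\boldsymbol\theta=(\boldsymbol\theta^1,\dots,\boldsymbol\theta^N)\in\boldsymbol\Theta^N$ the quantum neural network $\bar F_R^{n,\boldsymbol\theta}$ has the components $$\bar F_{R,j}^{n,\boldsymbol\theta}(p)=R-2R\big[\mathbb P_1^{n,\boldsymbol\theta^j}(p)+\mathbb P_2^{n,\boldsymbol\theta^j}(p)\big],\qquad j=1,\dots,N .$$ **Proposition.** Let $R,M>0$ and let $F=(F_1,\dots,F_N):\mathbb{R}^N\times\mathbb{R}^d\to\mathbb{R}^N$ be continuously differentiable with $F_j\in\mathcal F_R$, $\partial_iF_j\in\mathcal F$ and $\int\|\xi\|^4|\widehat{F_j}(\xi)|\,d\xi<\infty$ for all $i=1,\dots,N+d$ and $j=1,\dots,N$. Then for every integer $n\ge1$ (and every $\mathtt V$ as above) there is $\boldsymbol\theta\in\boldsymbol\Theta^N$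 such that for every $j\in\{1,\dots,N\}$ $$\big\|\bar F^{n,\boldsymbol\theta}_{R,j}-F_j\big\|_{\infty,M}+\sum_{i=1}^{N+d}\big\|\partial_i\bar F^{n,\boldsymbol\theta}_{R,j}-\partial_iF_j\big\|_{\infty,M}\le\frac{C_j^\infty}{\sqrt n},$$ where, with $I_{q,j}=\int\|\xi\|^q|\widehat{F_j}(\xi)|\,d\xi$, $$C_j^\infty=2(\pi+1)\|\widehat{F_j}\|_1+(8\pi M+4\pi^2)(N+d)^{1/2}\|\widehat{F_j}\|_1^{1/2}I_{2,j}^{1/2}+16M\pi^2(N+d)\|\widehat{F_j}\|_1^{1/2}I_{4,j}^{1/2}.$$ -/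

import Mathlib

open MeasureTheory
open scoped FourierTransform Matrix Kronecker

noncomputable section

namespace RQNN

/-- The space `ℝ^N × ℝ^d` of pairs `(x, z)` of a state and an input, with its `N + d` coordinates:
`Sum.inl k` indexes the coordinates of `x` and `Sum.inr k` those of `z`. It carries the Euclidean
norm, the Euclidean inner product and Lebesgue measure. -/
abbrev StateInput (N d : ℕ) : Type := EuclideanSpace ℝ (Fin N ⊕ Fin d)

/-! ### The function classes -/

/-- The Fourier transform `ξ ↦ ∫ exp(-2πi y·ξ) f(y) dy` of a real-valued function. -/
def fourierHat {N d : ℕ} (f : StateInput N d → ℝ) : StateInput N d → ℂ :=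
  𝓕 (fun y => (f y : ℂ))

/-- The class `𝓕` of continuous integrable functions with integrable Fourier transform. -/
def MemF {N d : ℕ} (f : StateInput N d → ℝ) : Prop :=
  Continuous f ∧ Integrable f volume ∧ Integrable (fourierHat f) volume

/-- The Fourier integral `‖f̂‖₁`. -/
def fourierNorm {N d : ℕ} (f : StateInput N d → ℝ) : ℝ :=
  ∫ ξ, ‖fourierHat f ξ‖

/-- The class `𝓕_R` of functions in `𝓕` with `‖f̂‖₁ ≤ R`. -/
def MemFR {N d : ℕ} (R : ℝ) (f : StateInput N d → ℝ) : Prop :=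
  MemF f ∧ fourierNorm f ≤ R

/-- The Fourier moment `I_q = ∫ ‖ξ‖^q |f̂(ξ)| dξ`. -/
def fourierMoment {N d : ℕ} (q : ℕ) (f : StateInput N d → ℝ) : ℝ :=
  ∫ ξ, ‖ξ‖ ^ q * ‖fourierHat f ξ‖

/-- The partial derivative in the `i`-th coordinate. -/
def partialDeriv {N d : ℕ} (i : Fin N ⊕ Fin d) (f : StateInput N d → ℝ) :
    StateInput N d → ℝ :=
  fun p => fderiv ℝ f p (EuclideanSpace.single i 1)

/-- The cube `[-M, M]^N × [-M, M]^d`. -/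
def cube (N d : ℕ) (M : ℝ) : Set (StateInput N d) :=
  {p | ∀ i, p i ∈ Set.Icc (-M) M}

/-- The uniform distance `‖f - g‖_{∞,M}` of two continuous functions on the cube. -/
def supDist {N d : ℕ} (M : ℝ) (f g : StateInput N d → ℝ) : ℝ :=
  ⨆ p : cube N d M, |f p - g p|

/-! ### Gates -/

/-- The Hadamard gate. -/
def gateH : Matrix (Fin 2) (Fin 2) ℂ :=
  (1 / (Real.sqrt 2 : ℂ)) • !![1, 1; 1, -1]

/-- The rotation around the `Y`-axis. -/
def gateRy (γ : ℝ) : Matrix (Fin 2) (Fin 2) ℂ :=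
  !![(Real.cos (γ / 2) : ℂ), -(Real.sin (γ / 2) : ℂ);
     (Real.sin (γ / 2) : ℂ), (Real.cos (γ / 2) : ℂ)]

/-- The rotation around the `Z`-axis. -/
def gateRz (α : ℝ) : Matrix (Fin 2) (Fin 2) ℂ :=
  !![Complex.exp (-Complex.I * (α / 2 : ℝ)), 0;
     0, Complex.exp (Complex.I * (α / 2 : ℝ))]

/-- The parameter set `Θ = (ℝ^{N+d} × ℝ × [0, 2π])^n` of one circuit; its elements are
`(aⁱ, bⁱ, γⁱ)`, `i = 1, …, n`. -/
abbrev Params (N d n : ℕ) : Type :=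
  Fin n → StateInput N d × ℝ × Set.Icc (0 : ℝ) (2 * Real.pi)

/-- The gate
`H R_z(-b) R_z(-a_{N+d} z_d) ⋯ R_z(-a_{N+1} z_1) R_z(-a_N x_N) ⋯ R_z(-a_1 x_1) H`. -/
def gateU1 {N d : ℕ} (a : StateInput N d) (b : ℝ) (p : StateInput N d) :
    Matrix (Fin 2) (Fin 2) ℂ :=
  gateH * gateRz (-b)
    * (List.ofFn fun k : Fin d => gateRz (-(a (Sum.inr k) * p (Sum.inr k)))).reverse.prod
    * (List.ofFn fun k : Fin N => gateRz (-(a (Sum.inl k) * p (Sum.inl k)))).reverse.prod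
    * gateH

/-- The two-qubit gate `U₁ ⊗ U₂` with `U₂ = R_y(γ)`, in the computational basis
`0, 1, 2, 3`, where `2 k + l` stands for `|k⟩ ⊗ |l⟩`. -/
def gateUbar {N d : ℕ} (a : StateInput N d) (b γ : ℝ) (p : StateInput N d) :
    Matrix (Fin 4) (Fin 4) ℂ :=
  Matrix.reindex finProdFinEquiv finProdFinEquiv (gateU1 a b p ⊗ₖ gateRy γ)

/-! ### The circuit -/

/-- The number of qubits: the least `𝔫` with `4 n ≤ 2 ^ 𝔫`. Thus `n₀ = 2 ^ 𝔫 - 4 n` is the least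
natural number for which `4 n + n₀` is a power of two. -/
def numQubits (n : ℕ) : ℕ := Nat.clog 2 (4 * n)

/-- The labels `0, …, 2 ^ 𝔫 - 1` of the computational basis states. -/
abbrev BasisIdx (n : ℕ) : Type := Fin (2 ^ numQubits n)

/-- The label `4 i + m`, with `i < n` and `m < 4`. -/
def blockIdx {n : ℕ} (i : Fin n) (m : Fin 4) : BasisIdx n :=
  ⟨4 * i.val + m.val,
    lt_of_lt_of_le (by omega : 4 * i.val + m.val < 4 * n) (Nat.le_pow_clog (by norm_num) _)⟩

/-- The block-diagonal gate `U_θ(x, z) = diag(Ū⁽¹⁾, …, Ū⁽ⁿ⁾, 1_{n₀ × n₀})`. -/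
def gateU {N d n : ℕ} (θ : Params N d n) (p : StateInput N d) :
    Matrix (BasisIdx n) (BasisIdx n) ℂ :=
  Matrix.of fun r s =>
    if h : r.val / 4 < n ∧ r.val / 4 = s.val / 4 then
      gateUbar (θ ⟨r.val / 4, h.1⟩).1 (θ ⟨r.val / 4, h.1⟩).2.1 (θ ⟨r.val / 4, h.1⟩).2.2 p
        ⟨r.val % 4, Nat.mod_lt _ (by norm_num)⟩ ⟨s.val % 4, Nat.mod_lt _ (by norm_num)⟩
    else if r = s then 1 else 0

/-- The initial state `|0⟩^{⊗𝔫}`. -/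
def ketZero (n : ℕ) : BasisIdx n → ℂ := Pi.single ⟨0, Nat.two_pow_pos _⟩ 1

/-- The state `|ψ⟩ = n^{-1/2} ∑_{i=0}^{n-1} |4i⟩`. -/
def ketPsi (n : ℕ) : BasisIdx n → ℂ :=
  (1 / (Real.sqrt n : ℂ)) • ∑ i : Fin n, Pi.single (blockIdx i 0) 1

/-- `V` is an admissible preparation gate: a unitary matrix with `V |0⟩^{⊗𝔫} = |ψ⟩`. -/
def IsPrepGate (n : ℕ) (V : Matrix (BasisIdx n) (BasisIdx n) ℂ) : Prop :=
  V ∈ Matrix.unitaryGroup (BasisIdx n) ℂ ∧ V *ᵥ ketZero n = ketPsi n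

/-- The circuit `C(x, z) = U_θ(x, z) V`. -/
def circuit {N d n : ℕ} (V : Matrix (BasisIdx n) (BasisIdx n) ℂ) (θ : Params N d n)
    (p : StateInput N d) : Matrix (BasisIdx n) (BasisIdx n) ℂ :=
  gateU θ p * V

/-- The probability that the measured state of `C(x, z) |0⟩^{⊗𝔫}` lies in
`{m, 4 + m, …, 4 (n - 1) + m}`. -/
def outputProb {N d n : ℕ} (V : Matrix (BasisIdx n) (BasisIdx n) ℂ) (θ : Params N d n)
    (m : Fin 4) (p : StateInput N d) : ℝ :=
  ∑ i : Fin n, ‖(circuit V θ p *ᵥ ketZero n) (blockIdx i m)‖ ^ 2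

/-- The `j`-th component `R - 2 R (P₁ + P₂)` of the state map of the recurrent quantum neural
network with circuit parameters `θ = (θ¹, …, θᴺ)`. -/
def rqnn {N d n : ℕ} (V : Matrix (BasisIdx n) (BasisIdx n) ℂ) (R : ℝ)
    (θ : Fin N → Params N d n) (j : Fin N) : StateInput N d → ℝ :=
  fun p => R - 2 * R * (outputProb V (θ j) 1 p + outputProb V (θ j) 2 p)

/-- The constant `C^∞` of the uniform error bound on `[-M, M]^{N+d}`. -/
def constInfty {N d : ℕ} (M : ℝ) (f : StateInput N d → ℝ) : ℝ :=
  2 * (Real.pi + 1) * fourierNorm f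
    + (8 * Real.pi * M + 4 * Real.pi ^ 2) * Real.sqrt (N + d : ℝ)
        * Real.sqrt (fourierNorm f) * Real.sqrt (fourierMoment 2 f)
    + 16 * M * Real.pi ^ 2 * (N + d : ℝ)
        * Real.sqrt (fourierNorm f) * Real.sqrt (fourierMoment 4 f)

end RQNN

end

/-! ### Rademacher averages -/

namespace Rademacher

/-! Computing amplitudes (`norm_sq_gateUbar`, `rqnn_eq`) shows that each output is an average of `n`
ridge functions `R cos γ · cos(p·a + b)`. So the quantum statement reduces to approximation by
shallow cosine networks whose weights lie in `[-R, R]`.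

Write `L = ‖f̂‖₁`. If `L > 0`, Fourier inversion exhibits `f` as the expectation of `L cos(2π p·ξ +
arg f̂(ξ))`, with `ξ` drawn from the probability density `|f̂|/L` (`eq_integral_ridge`).
Differentiating under the integral, `∂ᵢf` is the expectation of the `i`-th partial derivative of the
same random ridge function (`partialDeriv_eq_integral_ridge`). One i.i.d. sample of `n` frequencies
therefore serves `f` and all its partial derivatives.

The uniform deviation of the empirical sums is controlled by `lintegral_iSup_ridge_le`.
Symmetrization inserts random signs. The contraction principle removes the 1-Lipschitz activation,
which leaves a linear functional of `p`, and Cauchy-Schwarz reduces this to the norm of a Rademacher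
sum. That norm is of order `√n`, because distinct signs are orthogonal. The expected deviations of
`f` and of its partial derivatives add up to at most `√n` times the constant (`sum_deviation_le`),
so some sample does no worse (`exists_frequencies`). Dividing by `n` gives the rate, and `R cos γ =
L` is solvable since `L ≤ R` (`exists_params`). -/

/-- The sign encoded by a Boolean. -/
def sgn (b : Bool) : ℝ := cond b 1 (-1)

@[simp] lemma sgn_true : sgn true = 1 := rfl

@[simp] lemma sgn_false : sgn false = -1 := rfl

lemma sgn_not (b : Bool) : sgn (!b) = -sgn b := by cases b <;> simp

lemma sgn_mul_self (b : Bool) : sgn b * sgn b = 1 := by cases b <;> simp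

variable {ι : Type*} [DecidableEq ι]

/-- Flipping the `k`-th sign, as a permutation of the sign vectors. -/
def flip (k : ι) : Equiv.Perm (ι → Bool) :=
  Function.Involutive.toPerm (fun ε => Function.update ε k (!ε k)) (by
    intro ε
    ext l
    by_cases h : l = k
    · subst h; simp
    · simp [h])

lemma flip_apply (k : ι) (ε : ι → Bool) : flip k ε = Function.update ε k (!ε k) := rfl

@[simp] lemma flip_apply_same (k : ι) (ε : ι → Bool) : flip k ε k = !ε k := by
  simp [flip_apply]

lemma flip_apply_of_ne {k l : ι} (h : l ≠ k) (ε : ι → Bool) : flip k ε l = ε l := by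
  simp [flip_apply, h]


@[simp] lemma flip_flip (k : ι) (ε : ι → Bool) : flip k (flip k ε) = ε := by
  ext l
  by_cases h : l = k
  · subst h; simp
  · simp [flip_apply_of_ne h]

variable [Fintype ι]

/-- Comparison of Rademacher sums in a single sign. -/
lemma exists_selection_single {T : Type*} (k : ι) (H : (ι → Bool) → T → ℝ)
    (hH : ∀ ε, H (flip k ε) = H ε) (u v : T → ℝ) (huv : ∀ s t, |v s - v t| ≤ |u s - u t|)
    (τ : (ι → Bool) → T) :
    ∃ τ' : (ι → Bool) → T,
      ∑ ε, (H ε (τ ε) + sgn (ε k) * v (τ ε)) ≤ ∑ ε, (H ε (τ' ε) + sgn (ε k) * u (τ' ε)) := by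
  classical
  -- Pair each sign vector with its flip. Over a pair, the terms in `v` contribute at most `|v s - v
  -- t| ≤ |u s - u t|`, where `s`, `t` are the two selected points. Keeping or exchanging these
  -- points makes the terms in `u` contribute exactly `|u s - u t|`. The criterion is
  -- flip-invariant, so both members of a pair make the same choice.
  let keep : (ι → Bool) → Prop := fun ε =>
    0 ≤ sgn (ε k) * (u (τ ε) - u (τ (flip k ε)))
  have hkeep : ∀ ε, keep (flip k ε) ↔ keep ε := by
    intro ε
    simp only [keep, flip_apply_same, flip_flip, sgn_not]
    rw [show -sgn (ε k) * (u (τ (flip k ε)) - u (τ ε))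
      = sgn (ε k) * (u (τ ε) - u (τ (flip k ε))) by ring]
  refine ⟨fun ε => if keep ε then τ ε else τ (flip k ε), ?_⟩
  have key : ∀ G : (ι → Bool) → ℝ, 2 * ∑ ε, G ε = ∑ ε, (G ε + G (flip k ε)) := by
    intro G
    rw [Finset.sum_add_distrib, Equiv.sum_comp (flip k) G]
    ring
  refine le_of_mul_le_mul_left ?_ (two_pos : (0 : ℝ) < 2)
  rw [key, key]
  refine Finset.sum_le_sum fun ε _ => ?_
  have h := huv (τ ε) (τ (flip k ε))
  simp only [hH, flip_apply_same, sgn_not, flip_flip, hkeep]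
  by_cases hk : keep ε
  · simp only [hk, if_true]
    simp only [keep] at hk
    cases hε : ε k <;> simp only [hε, sgn_true, sgn_false] at hk ⊢
    · have h1 := neg_abs_le (v (τ ε) - v (τ (flip k ε)))
      rw [abs_of_nonpos (by linarith : u (τ ε) - u (τ (flip k ε)) ≤ 0)] at h
      linarith
    · have h1 := le_abs_self (v (τ ε) - v (τ (flip k ε)))
      rw [abs_of_nonneg (by linarith : 0 ≤ u (τ ε) - u (τ (flip k ε)))] at h
      linarith
  · simp only [hk, if_false]
    simp only [keep, not_le] at hk
    cases hε : ε k <;> simp only [hε, sgn_true, sgn_false] at hk ⊢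
    · have h1 := neg_abs_le (v (τ ε) - v (τ (flip k ε)))
      rw [abs_of_nonneg (by linarith : 0 ≤ u (τ ε) - u (τ (flip k ε)))] at h
      linarith
    · have h1 := le_abs_self (v (τ ε) - v (τ (flip k ε)))
      rw [abs_of_nonpos (by linarith : u (τ ε) - u (τ (flip k ε)) ≤ 0)] at h
      linarith

/-- The contraction principle for Rademacher sums, in terms of selections. -/
lemma exists_selection {T : Type*} (u v : ι → T → ℝ)
    (huv : ∀ k s t, |v k s - v k t| ≤ |u k s - u k t|) (τ : (ι → Bool) → T) :
    ∃ τ' : (ι → Bool) → T,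
      ∑ ε, ∑ k, sgn (ε k) * v k (τ ε) ≤ ∑ ε, ∑ k, sgn (ε k) * u k (τ' ε) := by
  -- Replace `v k` by `u k` one index at a time. The other summands do not involve the sign being
  -- treated, so they form the flip-invariant term `H`.
  suffices h : ∀ s : Finset ι, ∃ τ' : (ι → Bool) → T,
      ∑ ε, ∑ k, sgn (ε k) * v k (τ ε)
        ≤ ∑ ε, ∑ k, sgn (ε k) * (if k ∈ s then u k else v k) (τ' ε) by
    simpa using h Finset.univ
  intro s
  induction s using Finset.induction_on with
  | empty => exact ⟨τ, by simp⟩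
  | insert a s ha ih =>
    obtain ⟨τ₁, h₁⟩ := ih
    obtain ⟨τ₂, h₂⟩ := exists_selection_single a
      (fun ε t => ∑ k ∈ Finset.univ.erase a, sgn (ε k) * (if k ∈ s then u k else v k) t)
      (by
        intro ε
        funext t
        refine Finset.sum_congr rfl fun k hk => ?_
        rw [flip_apply_of_ne (Finset.ne_of_mem_erase hk)])
      (u a) (v a) (huv a) τ₁
    refine ⟨τ₂, h₁.trans ?_⟩
    refine le_trans (le_of_eq ?_) (h₂.trans (le_of_eq ?_)) <;>
      refine Finset.sum_congr rfl fun ε _ => ?_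
    · rw [← Finset.sum_erase_add _ _ (Finset.mem_univ a)]
      simp [ha]
    · rw [← Finset.sum_erase_add _ _ (Finset.mem_univ a)]
      congr 1
      · refine Finset.sum_congr rfl fun k hk => ?_
        simp [Finset.ne_of_mem_erase hk]
      · simp

/-- The two-sided contraction principle for Rademacher sums. -/
lemma sum_abs_contraction {T : Type*} (u v : ι → T → ℝ)
    (huv : ∀ k s t, |v k s - v k t| ≤ |u k s - u k t|) (t₀ : T) (h₀ : ∀ k, v k t₀ = 0)
    (B : (ι → Bool) → ℝ) (hB : ∀ ε t, ∑ k, sgn (ε k) * u k t ≤ B ε) (τ : (ι → Bool) → T) :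
    ∑ ε, |∑ k, sgn (ε k) * v k (τ ε)| ≤ 2 * ∑ ε, B ε := by
  classical
  -- Selecting `t₀`, where everything vanishes, whenever the sum is negative turns the positive part
  -- into an ordinary selection. Applying this to `v` and `-v` gives the absolute value and the
  -- factor 2.
  have one : ∀ w : ι → T → ℝ, (∀ k s t, |w k s - w k t| ≤ |u k s - u k t|) →
      (∀ k, w k t₀ = 0) → ∑ ε, max (∑ k, sgn (ε k) * w k (τ ε)) 0 ≤ ∑ ε, B ε := by
    intro w hw hw₀
    obtain ⟨τ', h⟩ := exists_selection u w hw
      (fun ε => if 0 ≤ ∑ k, sgn (ε k) * w k (τ ε) then τ ε else t₀)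
    refine le_trans (le_of_eq ?_) (h.trans (Finset.sum_le_sum fun ε _ => hB ε _))
    refine Finset.sum_congr rfl fun ε _ => ?_
    by_cases hε : 0 ≤ ∑ k, sgn (ε k) * w k (τ ε)
    · simp [hε]
    · simp only [hε, if_false, hw₀, mul_zero, Finset.sum_const_zero]
      exact max_eq_right (not_le.1 hε).le
  have h1 := one v huv h₀
  have h2 := one (fun k t => -v k t)
    (fun k s t => by
      rw [show -v k s - -v k t = -(v k s - v k t) by ring, abs_neg]; exact huv k s t)
    (fun k => by simp [h₀])
  have h3 : ∑ ε, |∑ k, sgn (ε k) * v k (τ ε)|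
      = ∑ ε, max (∑ k, sgn (ε k) * v k (τ ε)) 0
        + ∑ ε, max (∑ k, sgn (ε k) * -v k (τ ε)) 0 := by
    rw [← Finset.sum_add_distrib]
    refine Finset.sum_congr rfl fun ε _ => ?_
    simp only [mul_neg, Finset.sum_neg_distrib]
    rcases le_total 0 (∑ k, sgn (ε k) * v k (τ ε)) with h | h
    · rw [abs_of_nonneg h, max_eq_left h, max_eq_right (by linarith), add_zero]
    · rw [abs_of_nonpos h, max_eq_right h, max_eq_left (by linarith), zero_add]
  linarith

/-- A bound for all selections bounds the sum of the suprema. -/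
lemma sum_iSup_ofReal_le {α T : Type*} [Fintype α] [Nonempty T] (w : α → T → ℝ)
    (hw : ∀ a t, 0 ≤ w a t) (C : ℝ) (h : ∀ τ : α → T, ∑ a, w a (τ a) ≤ C) :
    ∑ a, ⨆ t, ENNReal.ofReal (w a t) ≤ ENNReal.ofReal C := by
  classical
  have hb : ∀ a, BddAbove (Set.range (w a)) := by
    intro a
    refine ⟨C, ?_⟩
    rintro _ ⟨t, rfl⟩
    exact (Finset.single_le_sum (f := fun a => w a t) (fun a _ => hw a t)
      (Finset.mem_univ a)).trans (h fun _ => t)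
  have h1 : ∀ a, ⨆ t, ENNReal.ofReal (w a t) ≤ ENNReal.ofReal (⨆ t, w a t) := fun a =>
    iSup_le fun t => ENNReal.ofReal_le_ofReal (le_ciSup (hb a) t)
  have h0 : ∀ a, 0 ≤ ⨆ t, w a t := fun a => Real.iSup_nonneg (hw a)
  refine (Finset.sum_le_sum fun a _ => h1 a).trans ?_
  rw [← ENNReal.ofReal_sum_of_nonneg fun a _ => h0 a]
  refine ENNReal.ofReal_le_ofReal (le_of_forall_pos_le_add fun δ hδ => ?_)
  -- Suprema need not be attained, so near-maximizers are selected with total slack at most `δ`. The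
  -- `+ 1` covers an empty `α`.
  have hδ' : 0 < δ / (Fintype.card α + 1) := by positivity
  choose τ hτ using fun a => exists_lt_of_lt_ciSup (f := w a) (sub_lt_self _ hδ')
  have h2 : ∑ a, ⨆ t, w a t ≤ ∑ a, (w a (τ a) + δ / (Fintype.card α + 1)) :=
    Finset.sum_le_sum fun a _ => by linarith [hτ a]
  rw [Finset.sum_add_distrib, Finset.sum_const, Finset.card_univ, nsmul_eq_mul] at h2
  have h3 : (Fintype.card α : ℝ) * (δ / (Fintype.card α + 1)) ≤ δ := by
    rw [mul_div_assoc', div_le_iff₀ (by positivity)]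
    nlinarith
  linarith [h τ]

variable {E : Type*} [NormedAddCommGroup E] [InnerProductSpace ℝ E]

/-- Flipping the `k`-th sign permutes the sign vectors and negates the summand. -/
lemma sum_sgn_mul_sgn {k l : ι} (h : k ≠ l) : ∑ ε : ι → Bool, sgn (ε k) * sgn (ε l) = 0 := by
  have h1 := Equiv.sum_comp (flip k) fun ε : ι → Bool => sgn (ε k) * sgn (ε l)
  simp only [flip_apply_same, flip_apply_of_ne h.symm, sgn_not, neg_mul,
    Finset.sum_neg_distrib] at h1
  linarith

/-- The second moment of a Rademacher sum. -/
lemma sum_norm_sq (z : ι → E) :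
    ∑ ε : ι → Bool, ‖∑ k, sgn (ε k) • z k‖ ^ 2
      = Fintype.card (ι → Bool) * ∑ k, ‖z k‖ ^ 2 := by
  simp only [← real_inner_self_eq_norm_sq, sum_inner, inner_sum, real_inner_smul_left,
    real_inner_smul_right]
  rw [Finset.sum_comm, Finset.mul_sum]
  refine Finset.sum_congr rfl fun k _ => ?_
  rw [Finset.sum_comm, Finset.sum_eq_single k]
  · simp [← mul_assoc, sgn_mul_self]
  · intro l _ hl
    simp only [← mul_assoc]
    rw [← Finset.sum_mul]
    first
      | rw [sum_sgn_mul_sgn hl, zero_mul]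
      | rw [sum_sgn_mul_sgn hl.symm, zero_mul]
  · simp

/-- The first moment of a Rademacher sum. -/
lemma sum_norm_le (z : ι → E) :
    ∑ ε : ι → Bool, ‖∑ k, sgn (ε k) • z k‖
      ≤ Fintype.card (ι → Bool) * √(∑ k, ‖z k‖ ^ 2) := by
  -- Cauchy-Schwarz over the sign vectors passes to the second moment.
  refine le_trans (Real.le_sqrt_of_sq_le (sq_sum_le_card_mul_sum_sq)) ?_
  rw [sum_norm_sq, Finset.card_univ, ← mul_assoc, ← sq,
    Real.sqrt_mul (by positivity), Real.sqrt_sq (by positivity)]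

end Rademacher

/-! ### Symmetrization -/

namespace Rademacher

variable {ι : Type*} [Fintype ι]

/-- Exchanging the two members of the pairs selected by a sign. -/
def swapIf {Ω : Type*} (b : Bool) : Ω × Ω → Ω × Ω := cond b id Prod.swap

lemma measurePreserving_swapIf {Ω : Type*} [MeasurableSpace Ω] (μ : Measure Ω)
    [IsProbabilityMeasure μ] (b : Bool) :
    MeasurePreserving (swapIf b) (μ.prod μ) (μ.prod μ) := by
  cases b
  · exact Measure.measurePreserving_swap
  · exact MeasurePreserving.id _

lemma apply_swapIf_sub {Ω : Type*} (g : Ω → ℝ) (b : Bool) (q : Ω × Ω) :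
    g (swapIf b q).1 - g (swapIf b q).2 = sgn b * g q.1 - sgn b * g q.2 := by
  cases b <;> simp [swapIf, add_comm, sub_eq_add_neg]

/-- The symmetrization inequality. -/
theorem lintegral_iSup_symmetrization [DecidableEq ι] {Ω T : Type*} [MeasurableSpace Ω]
    [Countable T] (μ : Measure Ω) [IsProbabilityMeasure μ] (g : T → Ω → ℝ)
    (hg : ∀ t, Measurable (g t)) (hi : ∀ t, Integrable (g t) μ) :
    (Fintype.card (ι → Bool) : ENNReal)
        * ∫⁻ ω, ⨆ t, ‖∑ k, (g t (ω k) - ∫ x, g t x ∂μ)‖ₑ ∂(Measure.pi fun _ : ι => μ)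
      ≤ 2 * ∑ ε : ι → Bool,
        ∫⁻ ω, ⨆ t, ‖∑ k, sgn (ε k) * g t (ω k)‖ₑ ∂(Measure.pi fun _ : ι => μ) := by
  set P := Measure.pi fun _ : ι => μ with hP
  set Q := Measure.pi fun _ : ι => μ.prod μ with hQ
  have hmA : ∀ ε : ι → Bool, Measurable fun ω : ι → Ω => ⨆ t, ‖∑ k, sgn (ε k) * g t (ω k)‖ₑ :=
    fun ε => Measurable.iSup fun t => (Finset.measurable_sum _ fun k _ =>
      ((hg t).comp (measurable_pi_apply k)).const_mul _).enorm
  have hmJ : Measurable fun w : (ι → Ω × Ω) => ⨆ t, ‖∑ k, (g t (w k).1 - g t (w k).2)‖ₑ :=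
    Measurable.iSup fun t => (Finset.measurable_sum _ fun k _ =>
      ((hg t).comp (measurable_fst.comp (measurable_pi_apply k))).sub
        ((hg t).comp (measurable_snd.comp (measurable_pi_apply k)))).enorm
  have hmK : Measurable fun q : (ι → Ω) × (ι → Ω) =>
      ⨆ t, ‖∑ k, (g t (q.1 k) - g t (q.2 k))‖ₑ :=
    Measurable.iSup fun t => (Finset.measurable_sum _ fun k _ =>
      ((hg t).comp ((measurable_pi_apply k).comp measurable_fst)).sub
        ((hg t).comp ((measurable_pi_apply k).comp measurable_snd))).enorm
  -- The mean is the integral over an independent second sample. Moving that integral outside the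
  -- norm and the supremum only increases the value.
  have step1 : ∫⁻ ω, ⨆ t, ‖∑ k, (g t (ω k) - ∫ x, g t x ∂μ)‖ₑ ∂P
      ≤ ∫⁻ w, ⨆ t, ‖∑ k, (g t (w k).1 - g t (w k).2)‖ₑ ∂Q := by
    have e1 := (measurePreserving_arrowProdEquivProdArrow Ω Ω ι (fun _ => μ)
      (fun _ => μ)).lintegral_comp hmK
    have e2 : ∫⁻ w, ⨆ t, ‖∑ k, (g t (w k).1 - g t (w k).2)‖ₑ ∂Q
        = ∫⁻ ω, ∫⁻ ω', ⨆ t, ‖∑ k, (g t (ω k) - g t (ω' k))‖ₑ ∂P ∂P := by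
      rw [← lintegral_prod _ hmK.aemeasurable]
      exact e1
    rw [e2]
    refine lintegral_mono fun ω => iSup_le fun t => ?_
    have e3 : ∑ k, (g t (ω k) - ∫ x, g t x ∂μ)
        = ∫ ω' : ι → Ω, ∑ k, (g t (ω k) - g t (ω' k)) ∂P := by
      have e4 : ∀ k, Integrable (fun ω' : ι → Ω => g t (ω k) - g t (ω' k)) P := fun k =>
        (integrable_const _).sub (integrable_comp_eval (i := k) (hi t))
      rw [integral_finsetSum _ fun k _ => e4 k]
      refine Finset.sum_congr rfl fun k _ => ?_
      rw [integral_sub (integrable_const _) (integrable_comp_eval (i := k) (hi t)),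
        integral_comp_eval (μ := fun _ : ι => μ) (i := k) (hi t).aestronglyMeasurable]
      simp
    rw [e3]
    refine (enorm_integral_le_lintegral_enorm _).trans (lintegral_mono fun ω' => ?_)
    exact le_iSup (fun t => ‖∑ k, (g t (ω k) - g t (ω' k))‖ₑ) t
  have step2 : ∀ ε : ι → Bool, ∫⁻ w, ⨆ t, ‖∑ k, (g t (w k).1 - g t (w k).2)‖ₑ ∂Q
      ≤ 2 * ∫⁻ ω, ⨆ t, ‖∑ k, sgn (ε k) * g t (ω k)‖ₑ ∂P := by
    intro ε
    -- Exchanging the two samples in any set of coordinates preserves the law, so arbitrary signs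
    -- may be inserted. The triangle inequality then separates the samples, at the cost of a factor
    -- 2.
    have hsw : MeasurePreserving (fun (w : ι → Ω × Ω) k => swapIf (ε k) (w k)) Q Q :=
      measurePreserving_pi _ _ fun k => measurePreserving_swapIf μ (ε k)
    have hfst : MeasurePreserving (fun (w : ι → Ω × Ω) k => (w k).1) Q P :=
      measurePreserving_pi _ _ fun k => measurePreserving_fst
    have hsnd : MeasurePreserving (fun (w : ι → Ω × Ω) k => (w k).2) Q P :=
      measurePreserving_pi _ _ fun k => measurePreserving_snd
    rw [← hsw.lintegral_comp hmJ]
    calc ∫⁻ w, ⨆ t, ‖∑ k, (g t (swapIf (ε k) (w k)).1 - g t (swapIf (ε k) (w k)).2)‖ₑ ∂Q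
        ≤ ∫⁻ w, ((⨆ t, ‖∑ k, sgn (ε k) * g t (w k).1‖ₑ)
            + ⨆ t, ‖∑ k, sgn (ε k) * g t (w k).2‖ₑ) ∂Q := by
          refine lintegral_mono fun w => iSup_le fun t => ?_
          simp only [apply_swapIf_sub, Finset.sum_sub_distrib]
          refine enorm_sub_le.trans (add_le_add ?_ ?_)
          · exact le_iSup (fun t => ‖∑ k, sgn (ε k) * g t (w k).1‖ₑ) t
          · exact le_iSup (fun t => ‖∑ k, sgn (ε k) * g t (w k).2‖ₑ) t
      _ = 2 * ∫⁻ ω, ⨆ t, ‖∑ k, sgn (ε k) * g t (ω k)‖ₑ ∂P := by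
          have hm : Measurable fun w : ι → Ω × Ω => ⨆ t, ‖∑ k, sgn (ε k) * g t (w k).1‖ₑ :=
            (hmA ε).comp hfst.measurable
          rw [lintegral_add_left hm, two_mul]
          congr 1
          · exact hfst.lintegral_comp (hmA ε)
          · exact hsnd.lintegral_comp (hmA ε)
  calc (Fintype.card (ι → Bool) : ENNReal)
        * ∫⁻ ω, ⨆ t, ‖∑ k, (g t (ω k) - ∫ x, g t x ∂μ)‖ₑ ∂P
      ≤ ∑ _ε : ι → Bool, ∫⁻ w, ⨆ t, ‖∑ k, (g t (w k).1 - g t (w k).2)‖ₑ ∂Q := by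
        rw [Finset.sum_const, Finset.card_univ, nsmul_eq_mul]
        gcongr
    _ ≤ ∑ ε : ι → Bool, 2 * ∫⁻ ω, ⨆ t, ‖∑ k, sgn (ε k) * g t (ω k)‖ₑ ∂P :=
        Finset.sum_le_sum fun ε _ => step2 ε
    _ = _ := by rw [Finset.mul_sum]

end Rademacher

/-! ### A uniform bound for empirical averages of ridge functions -/

namespace Rademacher

/-- Jensen's inequality for the concave square root; integrability comes from `√G ≤ 1 + G`. -/
lemma integral_sqrt_le {Ω : Type*} [MeasurableSpace Ω] (μ : Measure Ω) [IsProbabilityMeasure μ]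
    (G : Ω → ℝ) (h0 : ∀ ω, 0 ≤ G ω) (hG : Integrable G μ) :
    Integrable (fun ω => √(G ω)) μ ∧ ∫ ω, √(G ω) ∂μ ≤ √(∫ ω, G ω ∂μ) := by
  have hi : Integrable (fun ω => √(G ω)) μ := by
    refine Integrable.mono' ((integrable_const (1 : ℝ)).add hG)
      (Real.continuous_sqrt.comp_aestronglyMeasurable hG.aestronglyMeasurable)
      (Filter.Eventually.of_forall fun ω => ?_)
    rw [Real.norm_of_nonneg (Real.sqrt_nonneg _), Pi.add_apply, Real.sqrt_le_left (by linarith [h0 ω])]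
    nlinarith [h0 ω]
  exact ⟨hi, Real.strictConcaveOn_sqrt.concaveOn.le_map_integral
    Real.continuous_sqrt.continuousOn isClosed_Ici
    (Filter.Eventually.of_forall fun ω => h0 ω) hG hi⟩

variable {ι : Type*} [Fintype ι] [DecidableEq ι]

/-- Summing over the signs at a fixed sample leaves the root of a sum of squares. Jensen then moves
the expectation inside, where all coordinates have the same law. -/
lemma lintegral_sum_norm_le {Ω E : Type*} [MeasurableSpace Ω] (μ : Measure Ω)
    [IsProbabilityMeasure μ] [NormedAddCommGroup E] [InnerProductSpace ℝ E] (ζ : Ω → E)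
    (hζ : Integrable (fun x => ‖ζ x‖ ^ 2) μ) :
    ∫⁻ ω, ENNReal.ofReal (∑ ε : ι → Bool, ‖∑ k, sgn (ε k) • ζ (ω k)‖)
        ∂(Measure.pi fun _ : ι => μ)
      ≤ ENNReal.ofReal (Fintype.card (ι → Bool)
          * (√(Fintype.card ι) * √(∫ x, ‖ζ x‖ ^ 2 ∂μ))) := by
  have hk : ∀ k : ι, Integrable (fun ω : ι → Ω => ‖ζ (ω k)‖ ^ 2) (Measure.pi fun _ : ι => μ) :=
    fun k => integrable_comp_eval (μ := fun _ : ι => μ) (i := k) hζ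
  obtain ⟨h1, h2⟩ := integral_sqrt_le (Measure.pi fun _ : ι => μ)
    (fun ω => ∑ k, ‖ζ (ω k)‖ ^ 2) (fun ω => Finset.sum_nonneg fun k _ => sq_nonneg _)
    (integrable_finsetSum _ fun k _ => hk k)
  have h3 : ∫ ω, ∑ k, ‖ζ (ω k)‖ ^ 2 ∂(Measure.pi fun _ : ι => μ)
      = Fintype.card ι * ∫ x, ‖ζ x‖ ^ 2 ∂μ := by
    rw [integral_finsetSum _ fun k _ => hk k]
    have : ∀ k : ι, ∫ ω, ‖ζ (ω k)‖ ^ 2 ∂(Measure.pi fun _ : ι => μ) = ∫ x, ‖ζ x‖ ^ 2 ∂μ :=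
      fun k => integral_comp_eval (μ := fun _ : ι => μ) (i := k) (f := fun x => ‖ζ x‖ ^ 2)
        hζ.aestronglyMeasurable
    simp [this]
  rw [h3, Real.sqrt_mul (by positivity)] at h2
  calc _ ≤ ∫⁻ ω, ENNReal.ofReal (Fintype.card (ι → Bool) * √(∑ k, ‖ζ (ω k)‖ ^ 2))
        ∂(Measure.pi fun _ : ι => μ) :=
        lintegral_mono fun ω => ENNReal.ofReal_le_ofReal (sum_norm_le _)
    _ = ENNReal.ofReal (∫ ω, Fintype.card (ι → Bool) * √(∑ k, ‖ζ (ω k)‖ ^ 2)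
        ∂(Measure.pi fun _ : ι => μ)) :=
        (ofReal_integral_eq_lintegral_ofReal (h1.const_mul _)
          (Filter.Eventually.of_forall fun ω => by positivity)).symm
    _ ≤ _ := by
        rw [integral_const_mul]
        exact ENNReal.ofReal_le_ofReal (by gcongr)

variable {V : Type*} [NormedAddCommGroup V] [InnerProductSpace ℝ V]

/-- The supremum over a ball of a Rademacher sum of ridge functions. -/
lemma sum_iSup_ridge_le {T : Type*} [Nonempty T] (φ : ℝ → ℝ) (hφ : ∀ s t, |φ s - φ t| ≤ |s - t|)
    (ρ : ℝ) (p : T → V) (hp : ∀ t, ‖p t‖ ≤ ρ) (a : ι → V) (b c : ι → ℝ) :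
    ∑ ε : ι → Bool, ⨆ t, ‖∑ k, sgn (ε k) * (c k * φ (inner ℝ (p t) (a k) + b k))‖ₑ
      ≤ ENNReal.ofReal (∑ ε : ι → Bool, ‖∑ k, sgn (ε k) • (c k * φ (b k))‖)
        + ENNReal.ofReal (2 * ρ * ∑ ε : ι → Bool, ‖∑ k, sgn (ε k) • (c k • a k)‖) := by
  have hρ : 0 ≤ ρ := (norm_nonneg _).trans (hp (Classical.arbitrary T))
  rw [← ENNReal.ofReal_add (Finset.sum_nonneg fun _ _ => norm_nonneg _)
    (mul_nonneg (by positivity) (Finset.sum_nonneg fun _ _ => norm_nonneg _))]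
  simp only [← ofReal_norm]
  refine sum_iSup_ofReal_le _ (fun _ _ => norm_nonneg _) _ fun τ => ?_
  -- Contraction needs functions vanishing at a common point, so the value `φ (b k)` at the origin
  -- is split off. The index set is the whole ball because the points `p t` need not include the
  -- origin.
  have h := sum_abs_contraction (T := {q : V // ‖q‖ ≤ ρ})
    (fun k q => c k * inner ℝ (q : V) (a k))
    (fun k q => c k * (φ (inner ℝ (q : V) (a k) + b k) - φ (b k)))
    (by
      intro k s t
      rw [← mul_sub, ← mul_sub, abs_mul, abs_mul]
      refine mul_le_mul_of_nonneg_left ?_ (abs_nonneg _)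
      have := hφ (inner ℝ (s : V) (a k) + b k) (inner ℝ (t : V) (a k) + b k)
      rw [add_sub_add_right_eq_sub] at this
      rwa [sub_sub_sub_cancel_right])
    ⟨0, by simpa using hρ⟩ (fun k => by simp)
    (fun ε => ρ * ‖∑ k, sgn (ε k) • (c k • a k)‖)
    (by
      intro ε q
      have h1 : ∑ k, sgn (ε k) * (c k * inner ℝ (q : V) (a k))
          = inner ℝ (q : V) (∑ k, sgn (ε k) • (c k • a k)) := by
        simp only [inner_sum, real_inner_smul_right]
      rw [h1]
      exact (real_inner_le_norm _ _).trans
        (mul_le_mul_of_nonneg_right q.2 (norm_nonneg _)))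
    (fun ε => ⟨p (τ ε), hp _⟩)
  rw [← Finset.mul_sum, ← mul_assoc] at h
  refine le_trans ?_ (add_le_add le_rfl h)
  rw [← Finset.sum_add_distrib]
  refine Finset.sum_le_sum fun ε _ => ?_
  rw [← Real.norm_eq_abs]
  refine le_trans (le_of_eq ?_) (norm_add_le _ _)
  rw [← Finset.sum_add_distrib]
  congr 1
  refine Finset.sum_congr rfl fun k _ => ?_
  rw [smul_eq_mul]
  ring

/-- The expected uniform deviation of an empirical sum of ridge functions from its mean. -/
theorem lintegral_iSup_ridge_le {Ω T : Type*} [MeasurableSpace Ω] [Countable T] [Nonempty T]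
    [MeasurableSpace V] [BorelSpace V] [SecondCountableTopology V]
    (μ : Measure Ω) [IsProbabilityMeasure μ]
    (φ : ℝ → ℝ) (hφ : ∀ s t, |φ s - φ t| ≤ |s - t|) (hφ1 : ∀ s, |φ s| ≤ 1)
    (ρ : ℝ) (p : T → V) (hp : ∀ t, ‖p t‖ ≤ ρ) (a : Ω → V) (b c : Ω → ℝ)
    (ha : Measurable a) (hb : Measurable b) (hc : Measurable c)
    (hc2 : Integrable (fun x => c x ^ 2) μ) (hca : Integrable (fun x => c x ^ 2 * ‖a x‖ ^ 2) μ) :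
    ∫⁻ ω, ⨆ t, ‖∑ k, (c (ω k) * φ (inner ℝ (p t) (a (ω k)) + b (ω k))
        - ∫ x, c x * φ (inner ℝ (p t) (a x) + b x) ∂μ)‖ₑ ∂(Measure.pi fun _ : ι => μ)
      ≤ ENNReal.ofReal (√(Fintype.card ι)
          * (2 * √(∫ x, c x ^ 2 ∂μ) + 4 * ρ * √(∫ x, c x ^ 2 * ‖a x‖ ^ 2 ∂μ))) := by
  have hρ : 0 ≤ ρ := (norm_nonneg _).trans (hp (Classical.arbitrary T))
  have hφm : Measurable φ := by
    have : LipschitzWith 1 φ := LipschitzWith.of_dist_le_mul fun s t => by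
      simpa [Real.dist_eq] using hφ s t
    exact this.continuous.measurable
  have hci : Integrable c μ := by
    refine Integrable.mono' ((integrable_const (1 : ℝ)).add hc2) hc.aestronglyMeasurable
      (Filter.Eventually.of_forall fun ω => ?_)
    rw [Real.norm_eq_abs, Pi.add_apply, ← sq_abs]
    nlinarith [sq_nonneg (|c ω| - 1), abs_nonneg (c ω)]
  have hgm : ∀ t, Measurable fun x => c x * φ (inner ℝ (p t) (a x) + b x) := fun t =>
    hc.mul (hφm.comp ((Measurable.inner measurable_const ha).add hb))
  have hgi : ∀ t, Integrable (fun x => c x * φ (inner ℝ (p t) (a x) + b x)) μ := fun t => by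
    refine Integrable.mono hci (hgm t).aestronglyMeasurable
      (Filter.Eventually.of_forall fun ω => ?_)
    rw [norm_mul]
    exact mul_le_of_le_one_right (norm_nonneg _) (hφ1 _)
  have hcb : Measurable fun x => c x * φ (b x) := hc.mul (hφm.comp hb)
  have hcb2 : ∀ x, ‖c x * φ (b x)‖ ^ 2 ≤ c x ^ 2 := fun x => by
    rw [← sq_abs (c x), norm_mul]
    gcongr
    exact mul_le_of_le_one_right (norm_nonneg _) (hφ1 _)
  have hi1 : Integrable (fun x => ‖c x * φ (b x)‖ ^ 2) μ := by
    refine Integrable.mono' hc2 (hcb.norm.pow_const 2).aestronglyMeasurable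
      (Filter.Eventually.of_forall fun x => ?_)
    rw [Real.norm_of_nonneg (by positivity)]
    exact hcb2 x
  have hn2 : ∀ x, ‖c x • a x‖ ^ 2 = c x ^ 2 * ‖a x‖ ^ 2 := fun x => by
    rw [norm_smul, mul_pow, Real.norm_eq_abs, sq_abs]
  have hi2 : Integrable (fun x => ‖c x • a x‖ ^ 2) μ := by simpa only [hn2] using hca
  have hnn : ∀ x : ℝ, 0 ≤ (Fintype.card (ι → Bool) : ℝ) * (√(Fintype.card ι) * √x) :=
    fun x => by positivity
  have hρ2 : 0 ≤ 2 * ρ := by positivity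
  have A1 := lintegral_sum_norm_le (ι := ι) μ _ hi1
  have A2 := lintegral_sum_norm_le (ι := ι) μ _ hi2
  simp only [hn2] at A2
  have hNE : (Fintype.card (ι → Bool) : ENNReal) = ENNReal.ofReal (Fintype.card (ι → Bool)) := by
    rw [ENNReal.ofReal_natCast]
  have S := lintegral_iSup_symmetrization (ι := ι) μ
    (fun t x => c x * φ (inner ℝ (p t) (a x) + b x)) hgm hgi
  rw [hNE] at S
  have hmA : ∀ ε : ι → Bool, Measurable fun ω : ι → Ω =>
      ⨆ t, ‖∑ k, sgn (ε k) * (c (ω k) * φ (inner ℝ (p t) (a (ω k)) + b (ω k)))‖ₑ :=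
    fun ε => Measurable.iSup fun t => (Finset.measurable_sum _ fun k _ =>
      ((hgm t).comp (measurable_pi_apply k)).const_mul _).enorm
  have h1m : ∀ (k : ι) (r : ℝ), Measurable fun ω : ι → Ω => r • (c (ω k) * φ (b (ω k))) :=
    fun k r => measurable_const.mul (hcb.comp (measurable_pi_apply k))
  have h2m : ∀ ε : ι → Bool, Measurable fun ω : ι → Ω =>
      ∑ k, sgn (ε k) • (c (ω k) * φ (b (ω k))) :=
    fun ε => Finset.measurable_sum _ fun k _ => h1m k (sgn (ε k))
  have hm1 : Measurable fun ω : ι → Ω => ENNReal.ofReal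
      (∑ ε : ι → Bool, ‖∑ k, sgn (ε k) • (c (ω k) * φ (b (ω k)))‖) :=
    ENNReal.measurable_ofReal.comp (Finset.measurable_sum _ fun ε _ =>
      Measurable.norm (h2m ε))
  have B : ∑ ε : ι → Bool, ∫⁻ ω, ⨆ t,
        ‖∑ k, sgn (ε k) * (c (ω k) * φ (inner ℝ (p t) (a (ω k)) + b (ω k)))‖ₑ
          ∂(Measure.pi fun _ : ι => μ)
      ≤ ENNReal.ofReal ((Fintype.card (ι → Bool) : ℝ) * (√(Fintype.card ι) *
        (√(∫ x, c x ^ 2 ∂μ) + 2 * ρ * √(∫ x, c x ^ 2 * ‖a x‖ ^ 2 ∂μ)))) := by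
    rw [← lintegral_finsetSum _ fun ε _ => hmA ε]
    have hpt := fun ω : ι → Ω => sum_iSup_ridge_le φ hφ ρ p hp (fun k => a (ω k))
      (fun k => b (ω k)) (fun k => c (ω k))
    refine (lintegral_mono hpt).trans ?_
    rw [lintegral_add_left hm1]
    simp only [ENNReal.ofReal_mul hρ2]
    rw [lintegral_const_mul' _ _ ENNReal.ofReal_ne_top]
    refine (add_le_add A1 (mul_le_mul_right A2 _)).trans ?_
    rw [← ENNReal.ofReal_mul hρ2, ← ENNReal.ofReal_add (hnn _) (mul_nonneg hρ2 (hnn _))]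
    refine ENNReal.ofReal_le_ofReal ?_
    have h1 : √(∫ x, ‖c x * φ (b x)‖ ^ 2 ∂μ) ≤ √(∫ x, c x ^ 2 ∂μ) :=
      Real.sqrt_le_sqrt (integral_mono hi1 hc2 hcb2)
    have h2 : (Fintype.card (ι → Bool) : ℝ) * (√(Fintype.card ι) * √(∫ x, ‖c x * φ (b x)‖ ^ 2 ∂μ))
      ≤ (Fintype.card (ι → Bool) : ℝ) * (√(Fintype.card ι) * √(∫ x, c x ^ 2 ∂μ)) :=
      mul_le_mul_of_nonneg_left (mul_le_mul_of_nonneg_left h1 (Real.sqrt_nonneg _))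
        (Nat.cast_nonneg _)
    linarith
  have hN : (0 : ℝ) < Fintype.card (ι → Bool) := by exact_mod_cast Fintype.card_pos
  -- The factor 2 from symmetrization turns the coefficients `1` and `2ρ` into `2` and `4ρ`; the
  -- number of sign vectors then cancels.
  have F := S.trans (mul_le_mul_right B 2)
  rw [show (2 : ENNReal) = ENNReal.ofReal 2 by simp, ← ENNReal.ofReal_mul (by norm_num),
    show 2 * ((Fintype.card (ι → Bool) : ℝ) * (√(Fintype.card ι) *
        (√(∫ x, c x ^ 2 ∂μ) + 2 * ρ * √(∫ x, c x ^ 2 * ‖a x‖ ^ 2 ∂μ))))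
      = (Fintype.card (ι → Bool) : ℝ) * (√(Fintype.card ι)
          * (2 * √(∫ x, c x ^ 2 ∂μ) + 4 * ρ * √(∫ x, c x ^ 2 * ‖a x‖ ^ 2 ∂μ))) by ring,
    ENNReal.ofReal_mul hN.le] at F
  exact (ENNReal.mul_le_mul_iff_right (by simpa only [ne_eq, ENNReal.ofReal_eq_zero, not_le] using hN) ENNReal.ofReal_ne_top).1 F

end Rademacher

/-! ### The output of the circuit -/

namespace RQNN

lemma gateRz_mul (α β : ℝ) : gateRz α * gateRz β = gateRz (α + β) := by
  ext i j
  fin_cases i <;> fin_cases j <;>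
    simp [gateRz, Matrix.mul_apply, Fin.sum_univ_two, ← Complex.exp_add] <;> ring_nf

lemma gateRz_zero : gateRz 0 = 1 := by
  ext i j
  fin_cases i <;> fin_cases j <;> simp [gateRz]

lemma prod_gateRz (l : List ℝ) : (l.map gateRz).prod = gateRz l.sum := by
  induction l with
  | nil => simp [gateRz_zero]
  | cons a l ih => simp [ih, gateRz_mul]

lemma prod_ofFn_gateRz {k : ℕ} (f : Fin k → ℝ) :
    (List.ofFn fun i => gateRz (f i)).reverse.prod = gateRz (∑ i, f i) := by
  have h : (List.ofFn fun i => gateRz (f i)) = (List.ofFn f).map gateRz := by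
    rw [List.map_ofFn]; rfl
  rw [h, ← List.map_reverse, prod_gateRz, List.sum_reverse, List.sum_ofFn]

/-- Rotations about one axis compose by adding angles, so the circuit computes an affine form in
`p`. -/
lemma gateU1_eq {N d : ℕ} (a : StateInput N d) (b : ℝ) (p : StateInput N d) :
    gateU1 a b p = gateH * gateRz (-(inner ℝ p a + b)) * gateH := by
  rw [gateU1, prod_ofFn_gateRz, prod_ofFn_gateRz, mul_assoc gateH, gateRz_mul, mul_assoc gateH,
    gateRz_mul]
  congr 3
  rw [PiLp.inner_apply, Fintype.sum_sum_type]
  simp only [Finset.sum_neg_distrib, RCLike.inner_apply, conj_trivial]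
  ring

lemma sqrt_two_inv_mul_self : ((√2 : ℝ) : ℂ)⁻¹ * ((√2 : ℝ) : ℂ)⁻¹ = 1 / 2 := by
  rw [← mul_inv, ← Complex.ofReal_mul, Real.mul_self_sqrt (by norm_num)]
  norm_num

/-- Conjugation by Hadamard gates turns a rotation about `Z` into one about `X`, moving the phase `t
/ 2` into measurable amplitudes. -/
lemma conj_gateRz_zero_zero (t : ℝ) :
    (gateH * gateRz (-t) * gateH) 0 0 = Complex.cos (t / 2) := by
  simp only [gateH, gateRz, Complex.cos, Matrix.mul_apply, Fin.sum_univ_two, Matrix.smul_apply,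
    Matrix.of_apply, Matrix.cons_val', Matrix.cons_val_zero, Matrix.cons_val_one, smul_eq_mul,
    one_div, Matrix.cons_val_fin_one]
  push_cast
  linear_combination (norm := skip) (Complex.exp (t / 2 * Complex.I)
    + Complex.exp (-(t / 2) * Complex.I)) * sqrt_two_inv_mul_self
  ring_nf

lemma conj_gateRz_one_zero (t : ℝ) :
    (gateH * gateRz (-t) * gateH) 1 0 = Complex.I * Complex.sin (t / 2) := by
  simp only [gateH, gateRz, Complex.sin, Matrix.mul_apply, Fin.sum_univ_two, Matrix.smul_apply,
    Matrix.of_apply, Matrix.cons_val', Matrix.cons_val_zero, Matrix.cons_val_one, smul_eq_mul,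
    one_div, Matrix.cons_val_fin_one]
  push_cast
  have hI : Complex.I * ((Complex.exp (-(t / 2 : ℂ) * Complex.I)
      - Complex.exp (t / 2 * Complex.I)) * Complex.I / 2)
      = (Complex.exp (t / 2 * Complex.I) - Complex.exp (-(t / 2 : ℂ) * Complex.I)) / 2 := by
    linear_combination (Complex.exp (-(t / 2 : ℂ) * Complex.I)
      - Complex.exp (t / 2 * Complex.I)) / 2 * Complex.I_mul_I
  rw [hI]
  linear_combination (norm := skip) (Complex.exp (t / 2 * Complex.I)
    - Complex.exp (-(t / 2) * Complex.I)) * sqrt_two_inv_mul_self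
  ring_nf

/-- Outcomes 1 and 2 are those where the two qubits disagree: `cos²(t/2) sin²(γ/2) + sin²(t/2)
cos²(γ/2)`. The half-angle formulas make this a product of full-angle cosines. -/
lemma norm_sq_gateUbar {N d : ℕ} (a : StateInput N d) (b γ : ℝ) (p : StateInput N d) :
    ‖gateUbar a b γ p 1 0‖ ^ 2 + ‖gateUbar a b γ p 2 0‖ ^ 2
      = (1 - Real.cos (inner ℝ p a + b) * Real.cos γ) / 2 := by
  set t := inner ℝ p a + b with ht
  have h1 : gateUbar a b γ p 1 0 = Complex.cos (t / 2) * Real.sin (γ / 2) := by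
    have : gateUbar a b γ p 1 0 = gateU1 a b p 0 0 * gateRy γ 1 0 := rfl
    rw [this, gateU1_eq, conj_gateRz_zero_zero]
    rfl
  have h2 : gateUbar a b γ p 2 0
      = Complex.I * Complex.sin (t / 2) * Real.cos (γ / 2) := by
    have : gateUbar a b γ p 2 0 = gateU1 a b p 1 0 * gateRy γ 0 0 := rfl
    rw [this, gateU1_eq, conj_gateRz_one_zero]
    rfl
  have e : ((t : ℂ) / 2) = ((t / 2 : ℝ) : ℂ) := by push_cast; rfl
  rw [h1, h2, e, ← Complex.ofReal_cos, ← Complex.ofReal_sin]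
  simp only [norm_mul, Complex.norm_I, Complex.norm_real, one_mul, mul_pow, Real.norm_eq_abs,
    sq_abs]
  have c1 : Real.cos t = 2 * Real.cos (t / 2) ^ 2 - 1 := by
    rw [← Real.cos_two_mul]; congr 1; ring
  have c2 : Real.cos γ = 2 * Real.cos (γ / 2) ^ 2 - 1 := by
    rw [← Real.cos_two_mul]; congr 1; ring
  rw [c1, c2, Real.sin_sq, Real.sin_sq]
  ring

lemma gateU_blockIdx {N d n : ℕ} (θ : Params N d n) (p : StateInput N d) (i l : Fin n)
    (m : Fin 4) :
    gateU θ p (blockIdx i m) (blockIdx l 0)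
      = if l = i then gateUbar (θ i).1 (θ i).2.1 (θ i).2.2 p m 0 else 0 := by
  have hi : (blockIdx i m).val / 4 = i.val := by
    simp only [blockIdx]; omega
  have hl : (blockIdx l (0 : Fin 4)).val / 4 = l.val := by
    simp [blockIdx]
  have hm : (blockIdx i m).val % 4 = m.val := by
    simp only [blockIdx]; omega
  have hm0 : (blockIdx l (0 : Fin 4)).val % 4 = 0 := by
    simp [blockIdx]
  rw [gateU, Matrix.of_apply]
  simp only [hi, hl, hm, hm0]
  by_cases h : l = i
  · subst h
    simp
  · have h1 : ¬ (i.val < n ∧ i.val = l.val) := fun h' => h (Fin.ext h'.2.symm)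
    have h2 : blockIdx i m ≠ blockIdx l 0 := fun h' => h1 ⟨i.2, by rw [← hi, ← hl, h']⟩
    simp only [h1, h2, h, dif_neg, if_false, not_false_eq_true]

/-- The prepared state is supported on the labels `4l`, so only the first column of each block
contributes, with weight `1/√n`. -/
lemma circuit_mulVec {N d n : ℕ} {V : Matrix (BasisIdx n) (BasisIdx n) ℂ} (hV : IsPrepGate n V)
    (θ : Params N d n) (p : StateInput N d) (i : Fin n) (m : Fin 4) :
    (circuit V θ p *ᵥ ketZero n) (blockIdx i m)
      = 1 / (√n : ℂ) * gateUbar (θ i).1 (θ i).2.1 (θ i).2.2 p m 0 := by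
  rw [circuit, ← Matrix.mulVec_mulVec, hV.2, ketPsi, Matrix.mulVec_smul, Matrix.mulVec_sum,
    Pi.smul_apply, Finset.sum_apply, smul_eq_mul]
  simp [gateU_blockIdx]

/-- The recurrent quantum neural network is a shallow network with cosine activation. -/
theorem rqnn_eq {N d n : ℕ} (hn : 1 ≤ n) {V : Matrix (BasisIdx n) (BasisIdx n) ℂ}
    (hV : IsPrepGate n V) (R : ℝ) (θ : Fin N → Params N d n) (j : Fin N) (p : StateInput N d) :
    rqnn V R θ j p
      = (n : ℝ)⁻¹ * ∑ k, R * Real.cos (θ j k).2.2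
        * Real.cos (inner ℝ p (θ j k).1 + (θ j k).2.1) := by
  have hn0 : (0 : ℝ) < n := by exact_mod_cast hn
  have hs : ‖1 / (√n : ℂ)‖ ^ 2 = (n : ℝ)⁻¹ := by
    rw [norm_div, norm_one, Complex.norm_real, Real.norm_of_nonneg (Real.sqrt_nonneg _), div_pow,
      Real.sq_sqrt hn0.le, one_pow, one_div]
  simp only [rqnn, outputProb]
  rw [← Finset.sum_add_distrib]
  simp only [circuit_mulVec hV, norm_mul, mul_pow, hs, ← mul_add, norm_sq_gateUbar]
  rw [← Finset.mul_sum, ← Finset.sum_div, Finset.sum_sub_distrib]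
  simp only [Finset.sum_const, Finset.card_univ, Fintype.card_fin, nsmul_eq_mul, mul_one,
    mul_assoc, ← Finset.mul_sum]
  field_simp
  rw [sub_sub_cancel]
  congr 1
  exact Finset.sum_congr rfl fun k _ => mul_comm _ _

end RQNN

/-! ### The Fourier representation -/

namespace RQNN

variable {N d : ℕ}

/-- The probability measure with density proportional to `|f̂|`. -/
noncomputable def freqMeasure (f : StateInput N d → ℝ) : Measure (StateInput N d) :=
  volume.withDensity fun ξ => ENNReal.ofReal (‖fourierHat f ξ‖ / fourierNorm f)

/-- The phase `arg f̂`. -/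
noncomputable def phase (f : StateInput N d → ℝ) (ξ : StateInput N d) : ℝ :=
  Complex.arg (fourierHat f ξ)

lemma continuous_fourierHat {f : StateInput N d → ℝ} (hf : MemF f) : Continuous (fourierHat f) :=
  VectorFourier.fourierIntegral_continuous Real.continuous_fourierChar
    (by exact continuous_inner) hf.2.1.ofReal

lemma measurable_phase {f : StateInput N d → ℝ} (hf : MemF f) : Measurable (phase f) :=
  Complex.measurable_arg.comp (continuous_fourierHat hf).measurable

lemma measurable_density {f : StateInput N d → ℝ} (hf : MemF f) :
    Measurable fun ξ => ENNReal.ofReal (‖fourierHat f ξ‖ / fourierNorm f) :=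
  ((continuous_fourierHat hf).norm.measurable.div_const _).ennreal_ofReal

lemma fourierNorm_nonneg (f : StateInput N d → ℝ) : 0 ≤ fourierNorm f :=
  integral_nonneg fun _ => norm_nonneg _

lemma isProbabilityMeasure_freqMeasure {f : StateInput N d → ℝ} (hf : MemF f)
    (hL : 0 < fourierNorm f) : IsProbabilityMeasure (freqMeasure f) := by
  constructor
  rw [freqMeasure, withDensity_apply _ MeasurableSet.univ, Measure.restrict_univ,
    ← ofReal_integral_eq_lintegral_ofReal (hf.2.2.norm.div_const _)
      (Filter.Eventually.of_forall fun ξ => div_nonneg (norm_nonneg _) hL.le),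
    integral_div]
  rw [show ∫ ξ, ‖fourierHat f ξ‖ = fourierNorm f from rfl, div_self hL.ne', ENNReal.ofReal_one]

lemma integral_freqMeasure {f : StateInput N d → ℝ} (hf : MemF f) (h : StateInput N d → ℝ) :
    ∫ ξ, h ξ ∂(freqMeasure f) = (∫ ξ, h ξ * ‖fourierHat f ξ‖) / fourierNorm f := by
  rw [freqMeasure, integral_withDensity_eq_integral_toReal_smul (measurable_density hf)
    (Filter.Eventually.of_forall fun _ => ENNReal.ofReal_lt_top), ← integral_div]
  congr 1
  funext ξ
  rw [ENNReal.toReal_ofReal (div_nonneg (norm_nonneg _) (fourierNorm_nonneg f)), smul_eq_mul]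
  ring

lemma integrable_freqMeasure {f : StateInput N d → ℝ} (hf : MemF f) {h : StateInput N d → ℝ}
    (hh : Integrable fun ξ => h ξ * ‖fourierHat f ξ‖) : Integrable h (freqMeasure f) := by
  rw [freqMeasure, integrable_withDensity_iff_integrable_smul' (measurable_density hf)
    (Filter.Eventually.of_forall fun _ => ENNReal.ofReal_lt_top)]
  refine (hh.div_const (fourierNorm f)).congr (Filter.Eventually.of_forall fun ξ => ?_)
  simp only
  rw [ENNReal.toReal_ofReal (div_nonneg (norm_nonneg _) (fourierNorm_nonneg f)), smul_eq_mul]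
  ring

/-- Domination by `1 + ‖ξ‖ ^ 4` gives all lower moments. -/
lemma integrable_moment {f : StateInput N d → ℝ} (hf : MemF f)
    (h4 : Integrable fun ξ => ‖ξ‖ ^ 4 * ‖fourierHat f ξ‖) {q : ℕ} (hq : q ≤ 4) :
    Integrable fun ξ => ‖ξ‖ ^ q * ‖fourierHat f ξ‖ := by
  refine Integrable.mono' (hf.2.2.norm.add h4)
    ((continuous_norm.pow q).mul (continuous_fourierHat hf).norm).aestronglyMeasurable
    (Filter.Eventually.of_forall fun ξ => ?_)
  rw [Real.norm_of_nonneg (by positivity), Pi.add_apply, ← one_add_mul]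
  refine mul_le_mul_of_nonneg_right ?_ (norm_nonneg _)
  rcases le_total ‖ξ‖ 1 with h | h
  · have := pow_le_one₀ (n := q) (norm_nonneg ξ) h
    have h' : 0 ≤ ‖ξ‖ ^ 4 := by positivity
    linarith
  · have := pow_le_pow_right₀ h hq
    linarith

/-- Fourier inversion for a real-valued function. -/
lemma eq_integral_cos {f : StateInput N d → ℝ} (hf : MemF f) (p : StateInput N d) :
    f p = ∫ ξ, Real.cos (inner ℝ p ((2 * Real.pi) • ξ) + phase f ξ) * ‖fourierHat f ξ‖ := by
  have h1 : 𝓕⁻ (fourierHat f) = fun y => (f y : ℂ) :=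
    Continuous.fourierInv_fourier_eq (Complex.continuous_ofReal.comp hf.1) hf.2.1.ofReal hf.2.2
  have h2 := congrFun h1 p
  rw [Real.fourierInv_eq'] at h2
  have h3 : Integrable fun v : StateInput N d =>
      Complex.exp (↑(2 * Real.pi * inner ℝ v p) * Complex.I) • fourierHat f v := by
    refine Integrable.mono hf.2.2 ?_ (Filter.Eventually.of_forall fun v => ?_)
    · refine Continuous.aestronglyMeasurable ?_
      have := continuous_fourierHat hf
      fun_prop
    · rw [norm_smul, Complex.norm_exp_ofReal_mul_I, one_mul]
  have h4 := congrArg Complex.re h2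
  rw [Complex.ofReal_re] at h4
  rw [← h4, ← RCLike.re_eq_complex_re, ← integral_re h3]
  refine integral_congr_ae (Filter.Eventually.of_forall fun ξ => ?_)
  simp only [smul_eq_mul, RCLike.re_eq_complex_re]
  -- In polar form the phase of `f̂` becomes the bias of the ridge function, and the real part is a
  -- cosine.
  have h5 : fourierHat f ξ = ‖fourierHat f ξ‖ * Complex.exp (phase f ξ * Complex.I) :=
    (Complex.norm_mul_exp_arg_mul_I _).symm
  conv_lhs => rw [h5]
  rw [mul_left_comm, ← Complex.exp_add, ← add_mul, ← Complex.ofReal_add, Complex.re_ofReal_mul,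
    Complex.exp_ofReal_mul_I_re, real_inner_smul_right, real_inner_comm, mul_comm]

/-- The representation of `f` as a mixture of ridge functions. -/
lemma eq_integral_ridge {f : StateInput N d → ℝ} (hf : MemF f) (hL : 0 < fourierNorm f)
    (p : StateInput N d) :
    f p = ∫ ξ, fourierNorm f * Real.cos (inner ℝ p ((2 * Real.pi) • ξ) + phase f ξ)
      ∂(freqMeasure f) := by
  rw [integral_const_mul, integral_freqMeasure hf, mul_div_cancel₀ _ hL.ne',
    ← eq_integral_cos hf]

/-- The degenerate case, in which `freqMeasure f` cannot be normalized. -/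
lemma eq_zero_of_fourierNorm_eq_zero {f : StateInput N d → ℝ} (hf : MemF f)
    (hL : fourierNorm f = 0) (p : StateInput N d) : f p = 0 := by
  have h : (fun ξ => ‖fourierHat f ξ‖) =ᵐ[volume] 0 :=
    (integral_eq_zero_iff_of_nonneg (fun _ => norm_nonneg _) hf.2.2.norm).1 hL
  rw [eq_integral_cos hf]
  refine integral_eq_zero_of_ae ?_
  filter_upwards [h] with ξ hξ
  simp only [Pi.zero_apply] at hξ ⊢
  rw [hξ, mul_zero]

lemma hasDerivAt_ridge (p e a : StateInput N d) (b s : ℝ) :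
    HasDerivAt (fun s : ℝ => Real.cos (inner ℝ (p + s • e) a + b))
      (inner ℝ e a * -Real.sin (inner ℝ (p + s • e) a + b)) s := by
  have h : HasDerivAt (fun s : ℝ => inner ℝ (p + s • e) a + b) (inner ℝ e a) s := by
    simp only [inner_add_left, real_inner_smul_left]
    simpa using (((hasDerivAt_id s).mul_const (inner ℝ e a)).const_add (inner ℝ p a)).add_const b
  convert h.cos using 1
  ring

lemma inner_single_smul (i : Fin N ⊕ Fin d) (ξ : StateInput N d) :
    inner ℝ (EuclideanSpace.single i (1 : ℝ)) ((2 * Real.pi) • ξ) = 2 * Real.pi * ξ i := by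
  rw [EuclideanSpace.inner_single_left]
  simp

/-- The partial derivatives of `f` as mixtures of ridge functions. -/
lemma partialDeriv_eq_integral_ridge {f : StateInput N d → ℝ} (hf : MemF f)
    (hL : 0 < fourierNorm f) (h4 : Integrable fun ξ => ‖ξ‖ ^ 4 * ‖fourierHat f ξ‖)
    (hd : Differentiable ℝ f) (i : Fin N ⊕ Fin d) (p : StateInput N d) :
    partialDeriv i f p = ∫ ξ, 2 * Real.pi * fourierNorm f * ξ i
      * -Real.sin (inner ℝ p ((2 * Real.pi) • ξ) + phase f ξ) ∂(freqMeasure f) := by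
  have := isProbabilityMeasure_freqMeasure hf hL
  have hph := measurable_phase hf
  -- Along a coordinate line, compare this derivative with the one obtained under the integral sign,
  -- where the first moment supplies the dominating function.
  have h1 : HasDerivAt (fun s : ℝ => f (p + s • EuclideanSpace.single i (1 : ℝ)))
      (partialDeriv i f p) 0 :=
    (hd p).hasFDerivAt.hasLineDerivAt _
  have hm : ∀ q : StateInput N d, Measurable fun ξ : StateInput N d =>
      inner ℝ q ((2 * Real.pi) • ξ) + phase f ξ := fun q =>
    (Measurable.inner measurable_const (measurable_id.const_smul (2 * Real.pi))).add hph
  have hb : Integrable (fun ξ : StateInput N d => 2 * Real.pi * fourierNorm f * ‖ξ‖)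
      (freqMeasure f) := by
    have := integrable_moment hf h4 (q := 1) (by norm_num)
    simp only [pow_one] at this
    exact (integrable_freqMeasure hf this).const_mul _
  have h2 := (hasDerivAt_integral_of_dominated_loc_of_deriv_le (μ := freqMeasure f)
    (F := fun s ξ => fourierNorm f * Real.cos
      (inner ℝ (p + s • EuclideanSpace.single i (1 : ℝ)) ((2 * Real.pi) • ξ) + phase f ξ))
    (F' := fun s ξ => 2 * Real.pi * fourierNorm f * ξ i * -Real.sin
      (inner ℝ (p + s • EuclideanSpace.single i (1 : ℝ)) ((2 * Real.pi) • ξ) + phase f ξ))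
    (x₀ := (0 : ℝ)) (s := Set.univ) Filter.univ_mem
    (Filter.Eventually.of_forall fun s =>
      ((Real.measurable_cos.comp (hm _)).const_mul _).aestronglyMeasurable)
    (by
      refine Integrable.mono' (integrable_const (fourierNorm f))
        ((Real.measurable_cos.comp (hm _)).const_mul _).aestronglyMeasurable
        (Filter.Eventually.of_forall fun ξ => ?_)
      rw [norm_mul, Real.norm_of_nonneg hL.le]
      exact mul_le_of_le_one_right hL.le (Real.abs_cos_le_one _))
    (by
      refine (Measurable.mul ?_ (Real.measurable_sin.comp (hm _)).neg).aestronglyMeasurable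
      have : Continuous fun ξ : StateInput N d => 2 * Real.pi * fourierNorm f * ξ i := by fun_prop
      exact this.measurable)
    (Filter.Eventually.of_forall fun ξ s _ => by
      rw [norm_mul, norm_neg, norm_mul, Real.norm_of_nonneg (by positivity)]
      refine (mul_le_of_le_one_right (by positivity) (Real.abs_sin_le_one _)).trans ?_
      exact mul_le_mul_of_nonneg_left (PiLp.norm_apply_le ξ i) (by positivity))
    hb
    (Filter.Eventually.of_forall fun ξ s _ => by
      have := (hasDerivAt_ridge p (EuclideanSpace.single i (1 : ℝ)) ((2 * Real.pi) • ξ)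
        (phase f ξ) s).const_mul (fourierNorm f)
      rw [inner_single_smul] at this
      refine this.congr_deriv ?_
      ring)).2
  simp only [← eq_integral_ridge hf hL] at h2
  simpa using h1.unique h2

/-- The squared coordinates sum to `‖ξ‖ ^ 2`. The cases `q = 0` and `q = 2` produce `I₂` and `I₄`.
-/
lemma integral_sq_coord_sum {f : StateInput N d → ℝ} (hf : MemF f)
    (h4 : Integrable fun ξ => ‖ξ‖ ^ 4 * ‖fourierHat f ξ‖) {q : ℕ} (hq : q ≤ 2) :
    (∀ i, Integrable (fun ξ : StateInput N d => ξ i ^ 2 * ‖ξ‖ ^ q) (freqMeasure f)) ∧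
    ∑ i, ∫ ξ : StateInput N d, ξ i ^ 2 * ‖ξ‖ ^ q ∂(freqMeasure f)
      = fourierMoment (q + 2) f / fourierNorm f := by
  have hi : Integrable (fun ξ : StateInput N d => ‖ξ‖ ^ (q + 2)) (freqMeasure f) :=
    integrable_freqMeasure hf (integrable_moment hf h4 (by omega))
  have hI : ∀ i, Integrable (fun ξ : StateInput N d => ξ i ^ 2 * ‖ξ‖ ^ q) (freqMeasure f) := by
    intro i
    refine Integrable.mono' hi ?_ (Filter.Eventually.of_forall fun ξ => ?_)
    · refine Continuous.aestronglyMeasurable ?_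
      fun_prop
    · rw [Real.norm_of_nonneg (by positivity), pow_add, mul_comm]
      refine mul_le_mul_of_nonneg_left ?_ (by positivity)
      rw [← sq_abs]
      exact pow_le_pow_left₀ (abs_nonneg _) (PiLp.norm_apply_le ξ i) 2
  refine ⟨hI, ?_⟩
  rw [← integral_finsetSum _ fun i _ => hI i, fourierMoment, ← integral_freqMeasure hf]
  congr 1
  funext ξ
  rw [← Finset.sum_mul, pow_add, EuclideanSpace.norm_sq_eq]
  simp only [Real.norm_eq_abs, sq_abs]
  ring

end RQNN

/-! ### Existence of good parameters -/

namespace RQNN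

variable {N d : ℕ}

lemma zero_mem_cube {M : ℝ} (hM : 0 < M) : (0 : StateInput N d) ∈ cube N d M :=
  fun i => by simp [hM.le]

lemma norm_le_of_mem_cube {M : ℝ} (hM : 0 < M) {p : StateInput N d} (hp : p ∈ cube N d M) :
    ‖p‖ ≤ M * √(N + d : ℝ) := by
  rw [EuclideanSpace.norm_eq, ← Real.sqrt_sq hM.le, ← Real.sqrt_mul (sq_nonneg M)]
  refine Real.sqrt_le_sqrt ?_
  have h : ∀ i, ‖p i‖ ^ 2 ≤ M ^ 2 := fun i => by
    rw [Real.norm_eq_abs]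
    exact pow_le_pow_left₀ (abs_nonneg _) (abs_le.2 (hp i)) 2
  refine (Finset.sum_le_sum fun i _ => h i).trans (le_of_eq ?_)
  simp [mul_comm]

/-- The probabilistic bounds use countable suprema, for measurability; continuity carries them to
the whole cube. -/
lemma abs_le_of_dense {X T : Type*} [TopologicalSpace X] {h : X → ℝ} (hh : Continuous h)
    {u : T → X} (hu : DenseRange u) {C : ENNReal} (hC : C ≠ ⊤) (hle : ⨆ t, ‖h (u t)‖ₑ ≤ C) (x : X) :
    |h x| ≤ C.toReal := by
  refine hu.induction_on (p := fun x => |h x| ≤ C.toReal) x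
    (isClosed_le hh.abs continuous_const) fun t => ?_
  have h1 := (le_iSup (fun t => ‖h (u t)‖ₑ) t).trans hle
  have h2 := ENNReal.toReal_mono hC h1
  simpa using h2

/-- Cauchy-Schwarz; this costs a factor `√(N + d)` when the bounds for the partial derivatives are
summed. -/
lemma sum_sqrt_le {ι : Type*} [Fintype ι] (x : ι → ℝ) (hx : ∀ i, 0 ≤ x i) :
    ∑ i, √(x i) ≤ √(Fintype.card ι) * √(∑ i, x i) := by
  rw [← Real.sqrt_mul (by positivity)]
  refine Real.le_sqrt_of_sq_le (sq_sum_le_card_mul_sum_sq.trans (le_of_eq ?_))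
  simp [Real.sq_sqrt (hx _)]

lemma abs_neg_sin_sub_le (s t : ℝ) : |-Real.sin s - -Real.sin t| ≤ |s - t| := by
  rw [neg_sub_neg, abs_sub_comm]
  exact Real.abs_sin_sub_sin_le s t

/-- The bound on the summed expected deviations of a function and its partial derivatives. -/
lemma sum_deviation_le {f : StateInput N d → ℝ} (hf : MemF f) (hL : 0 < fourierNorm f)
    (h4 : Integrable fun ξ => ‖ξ‖ ^ 4 * ‖fourierHat f ξ‖) {M : ℝ} (hM : 0 < M) :
    (2 * √(∫ _ξ, fourierNorm f ^ 2 ∂(freqMeasure f))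
        + 4 * (M * √(N + d : ℝ)) * √(∫ ξ : StateInput N d, fourierNorm f ^ 2
          * ‖(2 * Real.pi) • ξ‖ ^ 2 ∂(freqMeasure f)))
      + ∑ i, (2 * √(∫ ξ : StateInput N d, (2 * Real.pi * fourierNorm f * ξ i) ^ 2
          ∂(freqMeasure f))
        + 4 * (M * √(N + d : ℝ)) * √(∫ ξ : StateInput N d,
          (2 * Real.pi * fourierNorm f * ξ i) ^ 2 * ‖(2 * Real.pi) • ξ‖ ^ 2 ∂(freqMeasure f)))
      ≤ constInfty M f := by
  have := isProbabilityMeasure_freqMeasure hf hL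
  set L := fourierNorm f with hLdef
  set D : ℝ := (N + d : ℝ) with hD
  have hD0 : 0 ≤ D := by positivity
  have hpi := Real.pi_pos
  have hn : ∀ ξ : StateInput N d, ‖(2 * Real.pi) • ξ‖ ^ 2 = 4 * Real.pi ^ 2 * ‖ξ‖ ^ 2 := by
    intro ξ
    rw [norm_smul, Real.norm_of_nonneg (by positivity)]
    ring
  have hI2 : 0 ≤ fourierMoment 2 f := integral_nonneg fun _ => by positivity
  have hI4 : 0 ≤ fourierMoment 4 f := integral_nonneg fun _ => by positivity
  -- Moments under `freqMeasure f` are `I / L`, so a weight `κ L` leaves `√L √I`, the shape found in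
  -- `constInfty`.
  have hsq : ∀ (κ I : ℝ), 0 ≤ κ → √((κ * L) ^ 2 * (I / L)) = κ * (√L * √I) := by
    intro κ I hκ
    rw [← Real.sqrt_mul hL.le, ← Real.sqrt_sq hκ, ← Real.sqrt_mul (sq_nonneg _),
      Real.sqrt_sq hκ]
    congr 1
    field_simp
  obtain ⟨-, s2⟩ := integral_sq_coord_sum hf h4 (q := 0) (by norm_num)
  obtain ⟨-, s4⟩ := integral_sq_coord_sum hf h4 (q := 2) (by norm_num)
  have e1 : √(∫ _ξ, L ^ 2 ∂(freqMeasure f)) = L := by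
    simp [Real.sqrt_sq hL.le]
  have e2 : √(∫ ξ : StateInput N d, L ^ 2 * ‖(2 * Real.pi) • ξ‖ ^ 2 ∂(freqMeasure f))
      = 2 * Real.pi * (√L * √(fourierMoment 2 f)) := by
    rw [← hsq _ _ (by positivity)]
    simp only [hn]
    rw [integral_const_mul, integral_const_mul, integral_freqMeasure hf]
    congr 1
    rw [fourierMoment]
    ring
  have card : (Fintype.card (Fin N ⊕ Fin d) : ℝ) = D := by simp [hD]
  have e3 : ∑ i, √(∫ ξ : StateInput N d, (2 * Real.pi * L * ξ i) ^ 2 ∂(freqMeasure f))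
      ≤ √D * (2 * Real.pi * (√L * √(fourierMoment 2 f))) := by
    refine (sum_sqrt_le _ fun i => integral_nonneg fun _ => by positivity).trans (le_of_eq ?_)
    rw [card, ← hsq _ _ (by positivity)]
    congr 2
    simp only [mul_pow _ (_ : ℝ) 2, pow_zero, mul_one, integral_const_mul] at s2 ⊢
    rw [← Finset.mul_sum, s2]
  have e4 : ∑ i, √(∫ ξ : StateInput N d, (2 * Real.pi * L * ξ i) ^ 2 * ‖(2 * Real.pi) • ξ‖ ^ 2
        ∂(freqMeasure f))
      ≤ √D * (4 * Real.pi ^ 2 * (√L * √(fourierMoment 4 f))) := by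
    refine (sum_sqrt_le _ fun i => integral_nonneg fun _ => by positivity).trans (le_of_eq ?_)
    rw [card, ← hsq _ _ (by positivity)]
    congr 2
    have : ∀ (i : Fin N ⊕ Fin d) (ξ : StateInput N d),
        (2 * Real.pi * L * ξ i) ^ 2 * ‖(2 * Real.pi) • ξ‖ ^ 2
          = (4 * Real.pi ^ 2 * L) ^ 2 * (ξ i ^ 2 * ‖ξ‖ ^ 2) := fun i ξ => by
      rw [hn]; ring
    simp only [this, integral_const_mul]
    rw [← Finset.mul_sum, s4]
  rw [e1, e2, Finset.sum_add_distrib, ← Finset.mul_sum, ← Finset.mul_sum, constInfty, ← hLdef,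
    ← hD]
  have hDD : √D * √D = D := Real.mul_self_sqrt hD0
  have hk : 0 ≤ 4 * (M * √D) := by positivity
  have f3 := mul_le_mul_of_nonneg_left e3 zero_le_two
  have f4 := mul_le_mul_of_nonneg_left e4 hk
  have f4' : 4 * (M * √D) * (√D * (4 * Real.pi ^ 2 * (√L * √(fourierMoment 4 f))))
      = 16 * M * Real.pi ^ 2 * D * √L * √(fourierMoment 4 f) := by
    linear_combination (16 * M * Real.pi ^ 2 * √L * √(fourierMoment 4 f)) * hDD
  rw [f4'] at f4
  -- Two coefficients have room to spare: `4π` against `4π²` here, and `2` against `2(π + 1)` in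
  -- front of `L` below.
  have g : 4 * Real.pi * (√D * √L * √(fourierMoment 2 f))
      ≤ 4 * Real.pi ^ 2 * (√D * √L * √(fourierMoment 2 f)) := by
    refine mul_le_mul_of_nonneg_right ?_ (by positivity)
    nlinarith [Real.pi_gt_three]
  have g' : 0 ≤ Real.pi * L := by positivity
  linarith

/-- Random frequencies give a network close to `f` together with its partial derivatives. -/
theorem exists_frequencies {f : StateInput N d → ℝ} (hf : MemF f) (hL : 0 < fourierNorm f)
    (h4 : Integrable fun ξ => ‖ξ‖ ^ 4 * ‖fourierHat f ξ‖) (hd : Differentiable ℝ f)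
    (hdc : ∀ i, Continuous (partialDeriv i f)) {M : ℝ} (hM : 0 < M) (n : ℕ) :
    ∃ (ω : Fin n → StateInput N d) (s₀ : ℝ) (s : Fin N ⊕ Fin d → ℝ),
      (∀ p ∈ cube N d M, |∑ k, (fourierNorm f
        * Real.cos (inner ℝ p ((2 * Real.pi) • ω k) + phase f (ω k)) - f p)| ≤ s₀) ∧
      (∀ i, ∀ p ∈ cube N d M, |∑ k, (2 * Real.pi * fourierNorm f * ω k i
        * -Real.sin (inner ℝ p ((2 * Real.pi) • ω k) + phase f (ω k))
          - partialDeriv i f p)| ≤ s i) ∧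
      s₀ + ∑ i, s i ≤ √n * constInfty M f := by
  have := isProbabilityMeasure_freqMeasure hf hL
  have : Nonempty (cube N d M) := ⟨⟨0, zero_mem_cube hM⟩⟩
  let u : ℕ → cube N d M := TopologicalSpace.denseSeq (cube N d M)
  have hu : DenseRange u := TopologicalSpace.denseRange_denseSeq _
  have hph := measurable_phase hf
  have ha : Measurable fun ξ : StateInput N d => (2 * Real.pi) • ξ :=
    measurable_id.const_smul (2 * Real.pi)
  have hcm : ∀ i : Fin N ⊕ Fin d, Measurable fun ξ : StateInput N d =>
      2 * Real.pi * fourierNorm f * ξ i := fun i => by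
    have : Continuous fun ξ : StateInput N d => 2 * Real.pi * fourierNorm f * ξ i := by fun_prop
    exact this.measurable
  have hn : ∀ ξ : StateInput N d, ‖(2 * Real.pi) • ξ‖ ^ 2 = 4 * Real.pi ^ 2 * ‖ξ‖ ^ 2 := by
    intro ξ
    rw [norm_smul, Real.norm_of_nonneg (by positivity)]
    ring
  have hi2 : Integrable (fun ξ : StateInput N d => ‖ξ‖ ^ 2) (freqMeasure f) :=
    integrable_freqMeasure hf (integrable_moment hf h4 (by norm_num))
  have A0 := Rademacher.lintegral_iSup_ridge_le (ι := Fin n) (freqMeasure f) Real.cos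
    Real.abs_cos_sub_cos_le Real.abs_cos_le_one (M * √(N + d : ℝ)) (fun t => (u t : StateInput N d))
    (fun t => norm_le_of_mem_cube hM (u t).2) (fun ξ => (2 * Real.pi) • ξ) (phase f)
    (fun _ => fourierNorm f) ha hph measurable_const (integrable_const _)
    (by simp only [hn]; exact (hi2.const_mul _).const_mul _)
  have A : ∀ i, _ := fun i => Rademacher.lintegral_iSup_ridge_le (ι := Fin n) (freqMeasure f)
    (fun x => -Real.sin x)
    abs_neg_sin_sub_le (fun x => by rw [abs_neg]; exact Real.abs_sin_le_one x)
    (M * √(N + d : ℝ)) (fun t => (u t : StateInput N d))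
    (fun t => norm_le_of_mem_cube hM (u t).2) (fun ξ => (2 * Real.pi) • ξ) (phase f)
    (fun ξ => 2 * Real.pi * fourierNorm f * ξ i) ha hph (hcm i)
    (by
      have := (integral_sq_coord_sum hf h4 (q := 0) (by norm_num)).1 i
      simp only [pow_zero, mul_one] at this
      simp only [mul_pow _ (_ : ℝ) 2]
      exact this.const_mul _)
    (by
      have := (integral_sq_coord_sum hf h4 (q := 2) (by norm_num)).1 i
      refine (this.const_mul ((4 * Real.pi ^ 2 * fourierNorm f) ^ 2)).congr
        (Filter.Eventually.of_forall fun ξ => ?_)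
      simp only [hn]
      ring)
  simp only [← eq_integral_ridge hf hL, ← partialDeriv_eq_integral_ridge hf hL h4 hd,
    Fintype.card_fin] at A0 A
  set P := Measure.pi fun _ : Fin n => freqMeasure f
  set S₀ : (Fin n → StateInput N d) → ENNReal := fun ω => ⨆ t, ‖∑ k, (fourierNorm f
    * Real.cos (inner ℝ (u t : StateInput N d) ((2 * Real.pi) • ω k) + phase f (ω k))
      - f (u t))‖ₑ with hS₀
  set S : Fin N ⊕ Fin d → (Fin n → StateInput N d) → ENNReal := fun i ω =>
    ⨆ t, ‖∑ k, (2 * Real.pi * fourierNorm f * ω k i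
      * -Real.sin (inner ℝ (u t : StateInput N d) ((2 * Real.pi) • ω k) + phase f (ω k))
        - partialDeriv i f (u t))‖ₑ with hS
  have hin : ∀ (t : ℕ) (k : Fin n), Measurable fun ω : Fin n → StateInput N d =>
      inner ℝ (u t : StateInput N d) ((2 * Real.pi) • ω k) + phase f (ω k) := fun t k =>
    (Measurable.inner measurable_const (ha.comp (measurable_pi_apply k))).add
      (hph.comp (measurable_pi_apply k))
  have hmS₀ : Measurable S₀ := by
    refine Measurable.iSup fun t => Measurable.enorm (Finset.measurable_sum _ fun k _ => ?_)
    exact (measurable_const.mul (Real.measurable_cos.comp (hin t k))).sub measurable_const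
  have hmS : ∀ i, Measurable (S i) := by
    intro i
    refine Measurable.iSup fun t => Measurable.enorm (Finset.measurable_sum _ fun k _ => ?_)
    exact (((hcm i).comp (measurable_pi_apply k)).mul
      (Real.measurable_sin.comp (hin t k)).neg).sub measurable_const
  -- The deviations are added before a sample is chosen, so that a single `ω` works for `f` and all
  -- partial derivatives together.
  have htot : ∫⁻ ω, (S₀ ω + ∑ i, S i ω) ∂P ≤ ENNReal.ofReal (√n * constInfty M f) := by
    rw [lintegral_add_left hmS₀, lintegral_finsetSum _ fun i _ => hmS i]
    refine (add_le_add A0 (Finset.sum_le_sum fun i _ => A i)).trans ?_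
    rw [← ENNReal.ofReal_sum_of_nonneg fun i _ => by positivity,
      ← ENNReal.ofReal_add (by positivity) (Finset.sum_nonneg fun i _ => by positivity),
      ← Finset.mul_sum, ← mul_add]
    exact ENNReal.ofReal_le_ofReal
      (mul_le_mul_of_nonneg_left (sum_deviation_le hf hL h4 hM) (Real.sqrt_nonneg _))
  obtain ⟨ω, hω⟩ := exists_le_lintegral (μ := P) (f := fun ω => S₀ ω + ∑ i, S i ω)
    (hmS₀.add (Finset.measurable_sum _ fun i _ => hmS i)).aemeasurable
  have hω' := hω.trans htot
  have hfin : S₀ ω + ∑ i, S i ω ≠ ⊤ := ne_top_of_le_ne_top ENNReal.ofReal_ne_top hω'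
  obtain ⟨hf0, hfs⟩ := ENNReal.add_ne_top.1 hfin
  have hfi : ∀ i, S i ω ≠ ⊤ := fun i => ENNReal.sum_ne_top.1 hfs i (Finset.mem_univ i)
  have hC : 0 ≤ √n * constInfty M f := by
    refine mul_nonneg (Real.sqrt_nonneg _) ?_
    have := fourierNorm_nonneg f
    have := Real.pi_pos
    rw [constInfty]
    positivity
  have hcin : ∀ k, Continuous fun p : cube N d M =>
      inner ℝ (p : StateInput N d) ((2 * Real.pi) • ω k) + phase f (ω k) := fun k => by fun_prop
  refine ⟨ω, (S₀ ω).toReal, fun i => (S i ω).toReal, fun p hp => ?_, fun i p hp => ?_, ?_⟩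
  · refine abs_le_of_dense (X := cube N d M) (h := fun p => ∑ k, (fourierNorm f
      * Real.cos (inner ℝ (p : StateInput N d) ((2 * Real.pi) • ω k) + phase f (ω k)) - f p))
      ?_ hu hf0 le_rfl ⟨p, hp⟩
    refine continuous_finsetSum _ fun k _ => ?_
    exact (continuous_const.mul (Real.continuous_cos.comp (hcin k))).sub
      (hf.1.comp continuous_subtype_val)
  · refine abs_le_of_dense (X := cube N d M) (h := fun p => ∑ k, (2 * Real.pi * fourierNorm f
      * ω k i * -Real.sin (inner ℝ (p : StateInput N d) ((2 * Real.pi) • ω k) + phase f (ω k))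
        - partialDeriv i f p)) ?_ hu (hfi i) le_rfl ⟨p, hp⟩
    refine continuous_finsetSum _ fun k _ => ?_
    exact (continuous_const.mul (Real.continuous_sin.comp (hcin k)).neg).sub
      ((hdc i).comp continuous_subtype_val)
  · have h := ENNReal.toReal_mono ENNReal.ofReal_ne_top hω'
    rwa [ENNReal.toReal_add hf0 hfs, ENNReal.toReal_sum fun i _ => hfi i,
      ENNReal.toReal_ofReal hC] at h

end RQNN

/-! ### The approximation theorem -/

namespace RQNN

variable {N d : ℕ}

lemma supDist_le {M : ℝ} (hM : 0 < M) {f g : StateInput N d → ℝ} {C : ℝ}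
    (h : ∀ p ∈ cube N d M, |f p - g p| ≤ C) : supDist M f g ≤ C :=
  have : Nonempty (cube N d M) := ⟨⟨0, zero_mem_cube hM⟩⟩
  ciSup_le fun p => h p p.2

/-- The shallow network with cosine activation realized by the circuits with parameters `θ`. -/
noncomputable def cosNet {n : ℕ} (R : ℝ) (θ : Params N d n) (p : StateInput N d) : ℝ :=
  (n : ℝ)⁻¹ * ∑ k, R * Real.cos (θ k).2.2 * Real.cos (inner ℝ p (θ k).1 + (θ k).2.1)

lemma differentiable_cosNet {n : ℕ} (R : ℝ) (θ : Params N d n) :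
    Differentiable ℝ (cosNet R θ) := by
  unfold cosNet
  refine Differentiable.const_mul (Differentiable.fun_sum fun k _ => ?_) _
  refine Differentiable.const_mul (Differentiable.cos ?_) _
  exact (differentiable_id.inner ℝ (differentiable_const _)).add_const _

lemma partialDeriv_cosNet {n : ℕ} (R : ℝ) (θ : Params N d n) (i : Fin N ⊕ Fin d)
    (p : StateInput N d) :
    partialDeriv i (cosNet R θ) p = (n : ℝ)⁻¹ * ∑ k, R * Real.cos (θ k).2.2
      * (inner ℝ (EuclideanSpace.single i (1 : ℝ)) (θ k).1
        * -Real.sin (inner ℝ p (θ k).1 + (θ k).2.1)) := by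
  have h1 : HasDerivAt
      (fun s : ℝ => cosNet R θ (p + s • EuclideanSpace.single i (1 : ℝ)))
      (partialDeriv i (cosNet R θ) p) 0 :=
    (differentiable_cosNet R θ p).hasFDerivAt.hasLineDerivAt _
  have h2 := (HasDerivAt.fun_sum (u := Finset.univ) fun k _ =>
    (hasDerivAt_ridge p (EuclideanSpace.single i (1 : ℝ)) (θ k).1 (θ k).2.1 0).const_mul
      (R * Real.cos (θ k).2.2)).const_mul (n : ℝ)⁻¹
  simpa using h1.unique h2

/-- A single circuit approximates `f` together with its partial derivatives. -/
theorem exists_params {R M : ℝ} (hR : 0 < R) (hM : 0 < M) {f : StateInput N d → ℝ}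
    (hf : MemFR R f) (h4 : Integrable fun ξ => ‖ξ‖ ^ 4 * ‖fourierHat f ξ‖)
    (hd : Differentiable ℝ f) (hdc : ∀ i, Continuous (partialDeriv i f)) {n : ℕ} (hn : 1 ≤ n) :
    ∃ θ : Params N d n, supDist M (cosNet R θ) f
      + ∑ i, supDist M (partialDeriv i (cosNet R θ)) (partialDeriv i f)
        ≤ constInfty M f / √n := by
  obtain ⟨hf, hLR⟩ := hf
  have hn0 : (0 : ℝ) < n := by exact_mod_cast hn
  have hpi := Real.pi_pos
  have hmem : ∀ x, Real.arccos x ∈ Set.Icc (0 : ℝ) (2 * Real.pi) := fun x =>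
    ⟨Real.arccos_nonneg _, (Real.arccos_le_pi _).trans (by linarith)⟩
  rcases (fourierNorm_nonneg f).eq_or_lt with hL | hL
  · have hf0 : f = fun _ => 0 := funext fun p => eq_zero_of_fourierNorm_eq_zero hf hL.symm p
    -- The angle `π / 2` gives every cosine weight zero, so the network vanishes identically, as `f`
    -- does.
    let θ : Params N d n := fun _ => (0, 0, ⟨Real.arccos 0, hmem 0⟩)
    have hg0 : cosNet R θ = f := by
      funext p
      simp [cosNet, θ, hf0]
    refine ⟨θ, ?_⟩
    rw [hg0]
    have : ∀ g : StateInput N d → ℝ, supDist M g g = 0 := fun g => by simp [supDist]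
    simp only [this, Finset.sum_const_zero, add_zero]
    have := fourierNorm_nonneg f
    rw [constInfty]
    positivity
  · obtain ⟨ω, s₀, s, h₀, h, hs⟩ := exists_frequencies hf hL h4 hd hdc hM n
    -- The one use of `‖f̂‖₁ ≤ R`: some angle `γ` realizes the common weight `L` of the sampled
    -- ridge functions.
    have hcos : R * Real.cos (Real.arccos (fourierNorm f / R)) = fourierNorm f := by
      rw [Real.cos_arccos (by linarith [div_pos hL hR]) ((div_le_one hR).2 hLR),
        mul_div_cancel₀ _ hR.ne']
    have avg : ∀ (x : Fin n → ℝ) (y C : ℝ), |∑ k, (x k - y)| ≤ C →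
        |(n : ℝ)⁻¹ * ∑ k, x k - y| ≤ (n : ℝ)⁻¹ * C := by
      intro x y C hC
      have : (n : ℝ)⁻¹ * ∑ k, x k - y = (n : ℝ)⁻¹ * ∑ k, (x k - y) := by
        rw [Finset.sum_sub_distrib, mul_sub]
        simp [hn0.ne']
      rw [this, abs_mul, abs_of_pos (inv_pos.2 hn0)]
      exact mul_le_mul_of_nonneg_left hC (inv_pos.2 hn0).le
    refine ⟨fun k => ((2 * Real.pi) • ω k, phase f (ω k),
      ⟨Real.arccos (fourierNorm f / R), hmem _⟩), ?_⟩
    have k0 : supDist M (cosNet R fun k => ((2 * Real.pi) • ω k, phase f (ω k),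
        ⟨Real.arccos (fourierNorm f / R), hmem _⟩)) f ≤ (n : ℝ)⁻¹ * s₀ := by
      refine supDist_le hM fun p hp => ?_
      rw [cosNet]
      simp only [hcos]
      exact avg _ _ _ (h₀ p hp)
    have k1 : ∀ i, supDist M (partialDeriv i (cosNet R fun k => ((2 * Real.pi) • ω k,
        phase f (ω k), ⟨Real.arccos (fourierNorm f / R), hmem _⟩))) (partialDeriv i f)
          ≤ (n : ℝ)⁻¹ * s i := by
      intro i
      refine supDist_le hM fun p hp => ?_
      rw [partialDeriv_cosNet]
      simp only [hcos, inner_single_smul]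
      refine avg _ _ _ (le_of_eq_of_le ?_ (h i p hp))
      congr 1
      refine Finset.sum_congr rfl fun k _ => ?_
      ring
    refine (add_le_add k0 (Finset.sum_le_sum fun i _ => k1 i)).trans ?_
    rw [← Finset.mul_sum, ← mul_add]
    refine (mul_le_mul_of_nonneg_left hs (inv_pos.2 hn0).le).trans (le_of_eq ?_)
    have hsq : √(n : ℝ) * √n = n := Real.mul_self_sqrt hn0.le
    have hs0 : √(n : ℝ) ≠ 0 := (Real.sqrt_pos.2 hn0).ne'
    rw [← mul_assoc, eq_div_iff hs0, inv_mul_eq_div]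
    nth_rewrite 2 [← hsq]
    field_simp

end RQNN

theorem mainTheorem3 {N d : ℕ} (R M : ℝ) (hR : 0 < R) (hM : 0 < M)
    (F : RQNN.StateInput N d → EuclideanSpace ℝ (Fin N))
    (hF : ContDiff ℝ 1 F)
    (hFR : ∀ j : Fin N, RQNN.MemFR R (fun p => F p j))
    (hdF : ∀ (j : Fin N) (i : Fin N ⊕ Fin d),
      RQNN.MemF (RQNN.partialDeriv i (fun p => F p j)))
    (hI4 : ∀ j : Fin N, MeasureTheory.Integrable
      (fun ξ : RQNN.StateInput N d => ‖ξ‖ ^ 4 * ‖RQNN.fourierHat (fun p => F p j) ξ‖)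
      MeasureTheory.volume)
    (n : ℕ) (hn : 1 ≤ n)
    (V : Matrix (RQNN.BasisIdx n) (RQNN.BasisIdx n) ℂ) (hV : RQNN.IsPrepGate n V) :
    ∃ θ : Fin N → RQNN.Params N d n, ∀ j : Fin N,
      RQNN.supDist M (RQNN.rqnn V R θ j) (fun p => F p j)
        + ∑ i : Fin N ⊕ Fin d,
            RQNN.supDist M (RQNN.partialDeriv i (RQNN.rqnn V R θ j))
              (RQNN.partialDeriv i (fun p => F p j))
        ≤ RQNN.constInfty M (fun p => F p j) / Real.sqrt n := by
  -- Each component has its own circuit parameters, so the components are approximated separately.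
  have key : ∀ j, ∃ θ : RQNN.Params N d n,
      RQNN.supDist M (RQNN.cosNet R θ) (fun p => F p j)
        + ∑ i, RQNN.supDist M (RQNN.partialDeriv i (RQNN.cosNet R θ))
            (RQNN.partialDeriv i (fun p => F p j))
        ≤ RQNN.constInfty M (fun p => F p j) / √n := fun j =>
    RQNN.exists_params hR hM (hFR j) (hI4 j)
      ((contDiff_euclidean.1 hF j).differentiable one_ne_zero) (fun i => (hdF j i).1) hn
  choose θ hθ using key
  refine ⟨θ, fun j => ?_⟩
  have h : RQNN.rqnn V R θ j = RQNN.cosNet R (θ j) :=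
    funext fun p => RQNN.rqnn_eq hn hV R θ j p
  rw [h]
  exact hθ j
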